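/- Let $G$ be a metric graph with vertex set $\mathcal V$ and edge set $\mathcal E$ (loops and multiple edges are allowed; $G$ is finite or, more generally, locally finite). Each edge $e$ is directed from an initial vertex to a terminal vertex and is identified with an interval $[0,L_e]$, with coordinate $x_e=0$ at the initial and $x_e=L_e$ at the terminal vertex; $L_e\in[L_{\min},L_{\max}]$ with $0<L_{\min}<L_{\max}<\infty$. For each edge let $\mathbf e_e=(e_x,e_y)\in\mathbb R^2$ be a unit vector and $A_e\in\mathbb R$ a constant, let $k_R\in\mathbb R$, and let $\epsilon(v)\in\mathbb R$ for each $v\in\mathcal V$. Put $$\sigma_e=\begin{pmatrix}0&e_y+\mathrm i e_x\\ e_y-\mathrm i e_x&0\end{pmatrix},\qquad \mathcal R_e=\Big(\mathrm i\frac{\mathrm d}{\mathrm dx_e}+A_e+k_R\sigma_e\Big)^2-k_R^2 .$$ In the Hilbert space $L^2(G)\otimes\mathbb C^2=\bigoplus_{e\in\mathcal E}L^2(0,L_e)\otimes\mathbb C^2$ let $\mathcal R$ be the operator $(f_e)_e\mapsto(\mathcal R_ef_e)_e$ whose domain consists of all $f\in L^2(G)\otimes\mathbb C^2$ with components $f_e\in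 W^{2,2}(0,L_e)\otimes\mathbb C^2$ and with $(\mathcal R_ef_e)_e\in L^2(G)\otimes\mathbb C^2$ (the last condition is automatic if $\mathcal E$ is finite) that satisfy at each vertex $v\in\mathcal V$ the continuity condition $$f_{e}(0)=f_{e'}(L_{e'})=f(v)\qquad\text{for all edges } e \text{ starting at } v \text{ and all edges } e' \text{ ending at } v,$$ with a common value $f(v)\in\mathbb C^2$, and the condition $$\sum_{e\ \text{starts at}\ v}\Big(\Big(\frac{\mathrm d}{\mathrm dx_e}-\mathrm i(A_e+k_R\sigma_e)\Big)f_e\Big)(0)\;-\sum_{e\ \text{ends at}\ v}\Big(\Big(\frac{\mathrm d}{\mathrm dx_e}-\mathrm i(A_e+k_R\sigma_e)\Big)f_e\Big)(L_e)=\epsilon(v)f(v).$$ Then $\mathcal R$ is densely defined and self-adjoint. -/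

import Mathlib

open MeasureTheory Set
open scoped ContDiff ENNReal

noncomputable section

namespace QuantumGraph

/-- A metric graph (loops and multiple edges allowed, possibly infinite but locally finite).
The edge `e` is the interval `[0, length e]`, directed from `src e` (at coordinate `0`) to
`tgt e` (at coordinate `length e`). -/
structure MetricGraph (V E : Type*) where
  src : E → V
  tgt : E → V
  length : E → ℝ
  minLength : ℝ
  maxLength : ℝ
  minLength_pos : 0 < minLength
  minLength_lt_maxLength : minLength < maxLength
  length_mem : ∀ e, length e ∈ Icc minLength maxLength
  finite_out : ∀ v, {e | src e = v}.Finite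
  finite_in : ∀ v, {e | tgt e = v}.Finite

/-- Two-component spinors, with the Hermitian norm. -/
abbrev Spinor : Type := EuclideanSpace ℂ (Fin 2)

/-- Lebesgue measure on `(0, L)`. -/
abbrev edgeMeasure (L : ℝ) : Measure ℝ := volume.restrict (Ioo 0 L)

/-- `L²(0, L) ⊗ ℂ²`. -/
abbrev EdgeL2 (L : ℝ) : Type := Lp Spinor 2 (edgeMeasure L)

/-- `L²(G) ⊗ ℂ²`, the Hilbert direct sum of the edge spaces. -/
abbrev GraphL2 {V E : Type*} (G : MetricGraph V E) : Type _ :=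
  lp (fun e => EdgeL2 (G.length e)) 2

/-- `g` is the weak derivative of `f` on `(0, L)`. -/
def IsWeakDeriv {L : ℝ} (f g : EdgeL2 L) : Prop :=
  ∀ φ : ℝ → ℝ, ContDiff ℝ ∞ φ → HasCompactSupport φ → tsupport φ ⊆ Ioo 0 L →
    ∫ x in Ioo 0 L, deriv φ x • f x = - ∫ x in Ioo 0 L, φ x • g x

section WeakDeriv

variable {L : ℝ}

theorem integrable_smul_edge {φ : ℝ → ℝ} (hφ : Continuous φ) (hc : HasCompactSupport φ)
    (f : EdgeL2 L) : Integrable (fun x => φ x • f x) (edgeMeasure L) := by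
  have hf : Integrable (fun x => f x) (edgeMeasure L) :=
    (Lp.memLp f).integrable (by norm_num)
  obtain ⟨C, hC⟩ := hc.exists_bound_of_continuous hφ
  exact hf.bdd_smul C hφ.aestronglyMeasurable (Filter.Eventually.of_forall hC)

theorem IsWeakDeriv.unique {f g g' : EdgeL2 L} (h : IsWeakDeriv f g) (h' : IsWeakDeriv f g') :
    g = g' := by
  have key : ∀ᵐ x, x ∈ Ioo (0 : ℝ) L → g x - g' x = 0 := by
    apply isOpen_Ioo.ae_eq_zero_of_integral_contDiff_smul_eq_zero
    · apply IntegrableOn.locallyIntegrableOn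
      exact ((Lp.memLp g).integrable (by norm_num)).sub ((Lp.memLp g').integrable (by norm_num))
    · intro φ hφ hc hs
      have e1 : ∫ x, φ x • (g x - g' x) = ∫ x in Ioo 0 L, φ x • (g x - g' x) := by
        symm
        apply setIntegral_eq_integral_of_forall_compl_eq_zero
        intro x hx
        rw [image_eq_zero_of_notMem_tsupport (fun hx' => hx (hs hx')), zero_smul]
      rw [e1]
      simp only [smul_sub]
      rw [integral_sub (integrable_smul_edge hφ.continuous hc g)
        (integrable_smul_edge hφ.continuous hc g')]
      have := (h φ hφ hc hs).symm.trans (h' φ hφ hc hs)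
      rw [neg_inj] at this
      exact sub_eq_zero.2 this
  apply Lp.ext
  have := (ae_restrict_iff' (μ := volume) measurableSet_Ioo).2 key
  filter_upwards [this] with x hx
  exact sub_eq_zero.1 hx

theorem IsWeakDeriv.add {f₁ g₁ f₂ g₂ : EdgeL2 L} (h₁ : IsWeakDeriv f₁ g₁)
    (h₂ : IsWeakDeriv f₂ g₂) : IsWeakDeriv (f₁ + f₂) (g₁ + g₂) := by
  intro φ hφ hc hs
  have hd : Continuous (deriv φ) := hφ.continuous_deriv (by simp)
  have e1 : ∫ x in Ioo 0 L, deriv φ x • (f₁ + f₂ : EdgeL2 L) x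
      = ∫ x in Ioo 0 L, (deriv φ x • f₁ x + deriv φ x • f₂ x) := by
    apply integral_congr_ae
    filter_upwards [Lp.coeFn_add f₁ f₂] with x hx
    rw [hx, Pi.add_apply, smul_add]
  have e2 : ∫ x in Ioo 0 L, φ x • (g₁ + g₂ : EdgeL2 L) x
      = ∫ x in Ioo 0 L, (φ x • g₁ x + φ x • g₂ x) := by
    apply integral_congr_ae
    filter_upwards [Lp.coeFn_add g₁ g₂] with x hx
    rw [hx, Pi.add_apply, smul_add]
  rw [e1, e2, integral_add (integrable_smul_edge hd hc.deriv f₁)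
    (integrable_smul_edge hd hc.deriv f₂), integral_add (integrable_smul_edge hφ.continuous hc g₁)
    (integrable_smul_edge hφ.continuous hc g₂), h₁ φ hφ hc hs, h₂ φ hφ hc hs, neg_add]

/-- Constant matrices (in particular scalars) commute with the weak derivative. -/
theorem IsWeakDeriv.map {f g : EdgeL2 L} (h : IsWeakDeriv f g) (T : Spinor →L[ℂ] Spinor) :
    IsWeakDeriv (T.compLpL 2 (edgeMeasure L) f) (T.compLpL 2 (edgeMeasure L) g) := by
  intro φ hφ hc hs
  have hd : Continuous (deriv φ) := hφ.continuous_deriv (by simp)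
  have aux : ∀ (ψ : ℝ → ℝ), Continuous ψ → HasCompactSupport ψ → ∀ u : EdgeL2 L,
      ∫ x in Ioo 0 L, ψ x • (T.compLpL 2 (edgeMeasure L) u) x
        = T (∫ x in Ioo 0 L, ψ x • u x) := by
    intro ψ hψ hψc u
    rw [← T.integral_comp_comm (integrable_smul_edge hψ hψc u)]
    apply integral_congr_ae
    filter_upwards [T.coeFn_compLpL (p := 2) (μ := edgeMeasure L) u] with x hx
    rw [hx, ← Complex.coe_smul, ← Complex.coe_smul, map_smul]
  rw [aux _ hd hc.deriv, aux _ hφ.continuous hc, h φ hφ hc hs, map_neg]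

theorem IsWeakDeriv.smul {f g : EdgeL2 L} (h : IsWeakDeriv f g) (c : ℂ) :
    IsWeakDeriv (c • f) (c • g) := by
  have := h.map (c • ContinuousLinearMap.id ℂ Spinor)
  have aux : ∀ u : EdgeL2 L,
      (c • ContinuousLinearMap.id ℂ Spinor).compLpL 2 (edgeMeasure L) u = c • u := by
    intro u
    apply Lp.ext
    filter_upwards [(c • ContinuousLinearMap.id ℂ Spinor).coeFn_compLpL (p := 2)
      (μ := edgeMeasure L) u, Lp.coeFn_smul c u] with x h1 h2
    rw [h1, h2]
    simp
  rwa [aux, aux] at this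

theorem IsWeakDeriv.zero : IsWeakDeriv (0 : EdgeL2 L) 0 := by
  intro φ _ _ _
  have aux : ∀ ψ : ℝ → ℝ, ∫ x in Ioo 0 L, ψ x • (0 : EdgeL2 L) x = 0 := by
    intro ψ
    rw [← integral_zero ℝ Spinor (μ := edgeMeasure L)]
    apply integral_congr_ae
    filter_upwards [Lp.coeFn_zero Spinor 2 (edgeMeasure L)] with x hx
    rw [hx]
    simp
  rw [aux, aux, neg_zero]

end WeakDeriv

/-- `W^{1,2}(0, L) ⊗ ℂ²`. -/
def SobolevOne (L : ℝ) : Submodule ℂ (EdgeL2 L) where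
  carrier := {f | ∃ g, IsWeakDeriv f g}
  zero_mem' := ⟨0, IsWeakDeriv.zero⟩
  add_mem' := fun ⟨_, h₁⟩ ⟨_, h₂⟩ => ⟨_, h₁.add h₂⟩
  smul_mem' := fun c _ ⟨_, h⟩ => ⟨_, h.smul c⟩

/-- `W^{2,2}(0, L) ⊗ ℂ²`. -/
def SobolevTwo (L : ℝ) : Submodule ℂ (EdgeL2 L) where
  carrier := {f | ∃ g h, IsWeakDeriv f g ∧ IsWeakDeriv g h}
  zero_mem' := ⟨0, 0, IsWeakDeriv.zero, IsWeakDeriv.zero⟩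
  add_mem' := fun ⟨_, _, h₁, k₁⟩ ⟨_, _, h₂, k₂⟩ => ⟨_, _, h₁.add h₂, k₁.add k₂⟩
  smul_mem' := fun c _ ⟨_, _, h, k⟩ => ⟨_, _, h.smul c, k.smul c⟩

open Classical in
/-- The weak derivative `d/dx`; it is used only on `W^{1,2}(0, L) ⊗ ℂ²`. -/
def weakDeriv {L : ℝ} (f : EdgeL2 L) : EdgeL2 L :=
  if h : ∃ g, IsWeakDeriv f g then h.choose else 0

theorem IsWeakDeriv.weakDeriv_eq {L : ℝ} {f g : EdgeL2 L} (h : IsWeakDeriv f g) :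
    weakDeriv f = g := by
  have h' : ∃ g, IsWeakDeriv f g := ⟨g, h⟩
  rw [weakDeriv, dif_pos h']
  exact h'.choose_spec.unique h

/-- The pointwise action of a constant `2 × 2` matrix. -/
def matAct {L : ℝ} (M : Matrix (Fin 2) (Fin 2) ℂ) : EdgeL2 L →L[ℂ] EdgeL2 L :=
  (Matrix.toEuclideanCLM (n := Fin 2) (𝕜 := ℂ) M).compLpL 2 (edgeMeasure L)

/-- The matrix `σ_e` of an edge with direction `d = (e_x, e_y)`. -/
def sigmaMatrix (d : EuclideanSpace ℝ (Fin 2)) : Matrix (Fin 2) (Fin 2) ℂ :=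
  !![0, (d 1 : ℂ) + Complex.I * (d 0 : ℂ); (d 1 : ℂ) - Complex.I * (d 0 : ℂ), 0]

/-- The matrix `A_e + k_R σ_e`. -/
def edgePotential (d : EuclideanSpace ℝ (Fin 2)) (a kR : ℝ) : Matrix (Fin 2) (Fin 2) ℂ :=
  (a : ℂ) • (1 : Matrix (Fin 2) (Fin 2) ℂ) + (kR : ℂ) • sigmaMatrix d

/-- `(i d/dx + M) f`. -/
def edgeMomentum {L : ℝ} (M : Matrix (Fin 2) (Fin 2) ℂ) (f : EdgeL2 L) : EdgeL2 L :=
  Complex.I • weakDeriv f + matAct M f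

/-- The covariant derivative `(d/dx - i M) f`. -/
def covDeriv {L : ℝ} (M : Matrix (Fin 2) (Fin 2) ℂ) (f : EdgeL2 L) : EdgeL2 L :=
  weakDeriv f - Complex.I • matAct M f

/-- The Rashba Hamiltonian `(i d/dx + A_e + k_R σ_e)² f - k_R² f` on an edge with direction `d`
and magnetic potential `a`; it is used only on `W^{2,2}(0, L) ⊗ ℂ²`. -/
def edgeRashba {L : ℝ} (d : EuclideanSpace ℝ (Fin 2)) (a kR : ℝ) (f : EdgeL2 L) : EdgeL2 L :=
  edgeMomentum (edgePotential d a kR) (edgeMomentum (edgePotential d a kR) f)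
    - ((kR : ℂ) ^ 2) • f

/-- The continuous representative of `f` on `[0, L]` takes the value `z` at `x`. Elements of
`W^{1,2}(0, L) ⊗ ℂ²` have a continuous representative, which is unique if `0 < L`. -/
def HasValueAt {L : ℝ} (f : EdgeL2 L) (x : ℝ) (z : Spinor) : Prop :=
  ∃ u : ℝ → Spinor, ContinuousOn u (Icc 0 L) ∧ f =ᵐ[edgeMeasure L] u ∧ u x = z

section Linear

variable {L : ℝ}

theorem SobolevTwo.le_one : SobolevTwo L ≤ SobolevOne L := fun _ ⟨g, _, h, _⟩ => ⟨g, h⟩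

theorem weakDeriv_add {f g : EdgeL2 L} (hf : f ∈ SobolevOne L) (hg : g ∈ SobolevOne L) :
    weakDeriv (f + g) = weakDeriv f + weakDeriv g := by
  obtain ⟨f', hf⟩ := hf
  obtain ⟨g', hg⟩ := hg
  rw [(hf.add hg).weakDeriv_eq, hf.weakDeriv_eq, hg.weakDeriv_eq]

theorem weakDeriv_smul (c : ℂ) {f : EdgeL2 L} (hf : f ∈ SobolevOne L) :
    weakDeriv (c • f) = c • weakDeriv f := by
  obtain ⟨f', hf⟩ := hf
  rw [(hf.smul c).weakDeriv_eq, hf.weakDeriv_eq]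

variable (M : Matrix (Fin 2) (Fin 2) ℂ)

theorem edgeMomentum_add {f g : EdgeL2 L} (hf : f ∈ SobolevOne L) (hg : g ∈ SobolevOne L) :
    edgeMomentum M (f + g) = edgeMomentum M f + edgeMomentum M g := by
  simp only [edgeMomentum, weakDeriv_add hf hg, map_add, smul_add]
  abel

theorem edgeMomentum_smul (c : ℂ) {f : EdgeL2 L} (hf : f ∈ SobolevOne L) :
    edgeMomentum M (c • f) = c • edgeMomentum M f := by
  simp only [edgeMomentum, weakDeriv_smul c hf, map_smul, smul_add, smul_comm Complex.I c]

theorem edgeMomentum_mem {f : EdgeL2 L} (hf : f ∈ SobolevTwo L) :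
    edgeMomentum M f ∈ SobolevOne L := by
  obtain ⟨g, h, hg, hh⟩ := hf
  refine ⟨Complex.I • h + matAct M g, ?_⟩
  rw [edgeMomentum, hg.weakDeriv_eq]
  exact (hh.smul _).add (hg.map _)

theorem covDeriv_add {f g : EdgeL2 L} (hf : f ∈ SobolevOne L) (hg : g ∈ SobolevOne L) :
    covDeriv M (f + g) = covDeriv M f + covDeriv M g := by
  simp only [covDeriv, weakDeriv_add hf hg, map_add, smul_add]
  abel

theorem covDeriv_smul (c : ℂ) {f : EdgeL2 L} (hf : f ∈ SobolevOne L) :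
    covDeriv M (c • f) = c • covDeriv M f := by
  simp only [covDeriv, weakDeriv_smul c hf, map_smul, smul_sub, smul_comm Complex.I c]

theorem edgeRashba_add (d : EuclideanSpace ℝ (Fin 2)) (a kR : ℝ) {f g : EdgeL2 L}
    (hf : f ∈ SobolevTwo L) (hg : g ∈ SobolevTwo L) :
    edgeRashba d a kR (f + g) = edgeRashba d a kR f + edgeRashba d a kR g := by
  simp only [edgeRashba]
  rw [edgeMomentum_add _ (SobolevTwo.le_one hf) (SobolevTwo.le_one hg),
    edgeMomentum_add _ (edgeMomentum_mem _ hf) (edgeMomentum_mem _ hg), smul_add]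
  abel

theorem edgeRashba_smul (d : EuclideanSpace ℝ (Fin 2)) (a kR : ℝ) (c : ℂ) {f : EdgeL2 L}
    (hf : f ∈ SobolevTwo L) :
    edgeRashba d a kR (c • f) = c • edgeRashba d a kR f := by
  simp only [edgeRashba]
  rw [edgeMomentum_smul _ c (SobolevTwo.le_one hf),
    edgeMomentum_smul _ c (edgeMomentum_mem _ hf), smul_sub, smul_comm _ c f]

theorem HasValueAt.add {f g : EdgeL2 L} {x : ℝ} {y z : Spinor} (hf : HasValueAt f x y)
    (hg : HasValueAt g x z) : HasValueAt (f + g) x (y + z) := by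
  obtain ⟨u, hu, hfu, rfl⟩ := hf
  obtain ⟨w, hw, hgw, rfl⟩ := hg
  exact ⟨u + w, hu.add hw, (Lp.coeFn_add f g).trans (hfu.add hgw), rfl⟩

theorem HasValueAt.smul {f : EdgeL2 L} {x : ℝ} {y : Spinor} (c : ℂ) (hf : HasValueAt f x y) :
    HasValueAt (c • f) x (c • y) := by
  obtain ⟨u, hu, hfu, rfl⟩ := hf
  exact ⟨c • u, hu.const_smul c, (Lp.coeFn_smul c f).trans (hfu.const_smul c), rfl⟩

theorem HasValueAt.zero (x : ℝ) : HasValueAt (0 : EdgeL2 L) x 0 :=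
  ⟨0, continuousOn_const, Lp.coeFn_zero _ _ _, rfl⟩

end Linear

namespace MetricGraph

variable {V E : Type*} (G : MetricGraph V E)

/-- The matching conditions. `F v` is the common value `f(v)`, and `p e`, `q e` are the values of
the covariant derivative of `f` on `e` at the initial and at the terminal end of `e`. -/
def VertexConditions (d : E → EuclideanSpace ℝ (Fin 2)) (A : E → ℝ) (kR : ℝ) (ε : V → ℝ)
    (f : ∀ e, EdgeL2 (G.length e)) : Prop :=
  ∃ (F : V → Spinor) (p q : E → Spinor),
    (∀ e, HasValueAt (f e) 0 (F (G.src e))) ∧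
    (∀ e, HasValueAt (f e) (G.length e) (F (G.tgt e))) ∧
    (∀ e, HasValueAt (covDeriv (edgePotential (d e) (A e) kR) (f e)) 0 (p e)) ∧
    (∀ e, HasValueAt (covDeriv (edgePotential (d e) (A e) kR) (f e)) (G.length e) (q e)) ∧
    ∀ v, ∑ e ∈ (G.finite_out v).toFinset, p e - ∑ e ∈ (G.finite_in v).toFinset, q e
      = (ε v : ℂ) • F v

/-- The domain of the Rashba Hamiltonian: all `f ∈ L²(G) ⊗ ℂ²` with `W^{2,2}` components for which
the image is again in `L²(G) ⊗ ℂ²` (automatic on finite graphs) and which satisfy the matching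
conditions. -/
def rashbaDomain (d : E → EuclideanSpace ℝ (Fin 2)) (A : E → ℝ) (kR : ℝ) (ε : V → ℝ) :
    Submodule ℂ (GraphL2 G) where
  carrier := {f | (∀ e, f e ∈ SobolevTwo (G.length e)) ∧
    Memℓp (fun e => edgeRashba (d e) (A e) kR (f e)) 2 ∧
    G.VertexConditions d A kR ε (fun e => f e)}
  zero_mem' := by
    have h0 : ∀ e, (0 : GraphL2 G) e = 0 := fun e => rfl
    have hz : ∀ e, edgeRashba (d e) (A e) kR (0 : EdgeL2 (G.length e)) = 0 := fun e => by
      have := edgeRashba_smul (d e) (A e) kR 0 (SobolevTwo (G.length e)).zero_mem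
      simpa using this
    have hc : ∀ e, covDeriv (edgePotential (d e) (A e) kR) (0 : EdgeL2 (G.length e)) = 0 :=
      fun e => by
        have := covDeriv_smul (edgePotential (d e) (A e) kR) 0
          (SobolevOne (G.length e)).zero_mem
        simpa using this
    refine ⟨fun e => (SobolevTwo _).zero_mem, ?_, 0, 0, 0, fun e => HasValueAt.zero _,
      fun e => HasValueAt.zero _, fun e => ?_, fun e => ?_, fun v => by simp⟩
    · simp only [h0, hz]
      exact zero_memℓp
    · simp only [h0, hc]
      exact HasValueAt.zero _
    · simp only [h0, hc]
      exact HasValueAt.zero _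
  add_mem' := by
    rintro f g ⟨hf, hRf, F, p, q, h1, h2, h3, h4, h5⟩ ⟨hg, hRg, F', p', q', k1, k2, k3, k4, k5⟩
    have ha : ∀ e, (f + g : GraphL2 G) e = f e + g e := fun e => rfl
    have hd : ∀ e, covDeriv (edgePotential (d e) (A e) kR) (f e + g e) = _ := fun e =>
      covDeriv_add (edgePotential (d e) (A e) kR) (SobolevTwo.le_one (hf e))
        (SobolevTwo.le_one (hg e))
    refine ⟨fun e => (SobolevTwo _).add_mem (hf e) (hg e), ?_, F + F', p + p', q + q',
      fun e => (h1 e).add (k1 e), fun e => (h2 e).add (k2 e), fun e => ?_, fun e => ?_,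
      fun v => ?_⟩
    · have : (fun e => edgeRashba (d e) (A e) kR ((f + g : GraphL2 G) e))
          = (fun e => edgeRashba (d e) (A e) kR (f e)) +
            fun e => edgeRashba (d e) (A e) kR (g e) :=
        funext fun e => edgeRashba_add _ _ _ (hf e) (hg e)
      rw [this]
      exact hRf.add hRg
    · simp only [ha, hd]
      exact (h3 e).add (k3 e)
    · simp only [ha, hd]
      exact (h4 e).add (k4 e)
    · simp only [Pi.add_apply, Finset.sum_add_distrib, smul_add, ← h5 v, ← k5 v]
      abel
  smul_mem' := by
    rintro c f ⟨hf, hRf, F, p, q, h1, h2, h3, h4, h5⟩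
    have ha : ∀ e, (c • f : GraphL2 G) e = c • f e := fun e => rfl
    have hd : ∀ e, covDeriv (edgePotential (d e) (A e) kR) (c • f e) = _ := fun e =>
      covDeriv_smul (edgePotential (d e) (A e) kR) c (SobolevTwo.le_one (hf e))
    refine ⟨fun e => (SobolevTwo _).smul_mem c (hf e), ?_, c • F, c • p, c • q,
      fun e => (h1 e).smul c, fun e => (h2 e).smul c, fun e => ?_, fun e => ?_,
      fun v => ?_⟩
    · have : (fun e => edgeRashba (d e) (A e) kR ((c • f : GraphL2 G) e))
          = c • (fun e => edgeRashba (d e) (A e) kR (f e)) :=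
        funext fun e => edgeRashba_smul _ _ _ c (hf e)
      rw [this]
      exact hRf.const_smul c
    · simp only [ha, hd]
      exact (h3 e).smul c
    · simp only [ha, hd]
      exact (h4 e).smul c
    · simp only [Pi.smul_apply, ← Finset.smul_sum, smul_comm _ c (F v), ← h5 v, smul_sub]

/-- The Rashba Hamiltonian on the graph, as an unbounded operator in `L²(G) ⊗ ℂ²`. Here `d e` is
the direction of the edge `e` in the plane, `A e` its magnetic potential, `kR` the Rashba coupling
constant and `ε v` the coupling at the vertex `v`. -/
def rashbaHamiltonian (d : E → EuclideanSpace ℝ (Fin 2)) (A : E → ℝ) (kR : ℝ) (ε : V → ℝ) :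
    GraphL2 G →ₗ.[ℂ] GraphL2 G where
  domain := G.rashbaDomain d A kR ε
  toFun :=
    { toFun := fun f => ⟨fun e => edgeRashba (d e) (A e) kR (f.1 e), f.2.2.1⟩
      map_add' := fun f g => lp.ext (funext fun e =>
        edgeRashba_add _ _ _ (f.2.1 e) (g.2.1 e))
      map_smul' := fun c f => lp.ext (funext fun e =>
        edgeRashba_smul _ _ _ c (f.2.1 e)) }

end MetricGraph

end QuantumGraph

end

/-! Write `D = d/dx - iM` with `M = A_e + k_R σ_e`. Since `M` is Hermitian, `iM` is skew, so `D`
integrates by parts like `d/dx`, and on every edge the Hamiltonian is `-D² - k_R²`. Green's formula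
then leaves only boundary terms pairing values with outgoing covariant derivatives
(`EdgeTraces.green_rashba`); summed over the graph they regroup by vertices
(`HasTraces.hasSum_green`). Under the matching conditions each vertex contributes `⟪ε F, F'⟫ - ⟪F, ε
F'⟫ = 0`, because `ε` is real, so the operator is symmetric.

Conversely, let `f` be in the adjoint domain with image `w`. Testing against functions supported
inside one edge shows that `f` is `W^{2,2}` there and that the edge expression gives `w`
(`edgeRashba_eq_of_weak`). The same functions give density. Testing next against domain elements
whose boundary data live at one vertex (`exists_vertex_test`) forces continuity and the derivative
condition there (`mem_rashbaDomain_of_adjoint`). These test elements have finitely many nonzero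
components, so no bound on `ε` is needed.

On an infinite graph the vertex sum must converge, so traces have to be square summable. This
follows from a trace estimate uniform over all edges (`EdgeTraces.exists_bound`), obtained by
duality: pair `f` in Green's formula with a function having one nonzero trace. Such functions are
cubic profiles times the covariantly constant frame `exp(i(x-a)M)c`. The frame has constant norm and
`D` differentiates only the profile, so the bounds depend on the length range but not on the
possibly unbounded `A_e`. -/

open scoped InnerProductSpace

/-! ### Vector-valued absolutely continuous functions: fundamental theorem and product rule. -/

section AbsolutelyContinuous

variable {F F₁ F₂ F₃ : Type*} [NormedAddCommGroup F] [NormedSpace ℝ F]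
  [NormedAddCommGroup F₁] [NormedSpace ℝ F₁] [NormedAddCommGroup F₂] [NormedSpace ℝ F₂]
  [NormedAddCommGroup F₃] [NormedSpace ℝ F₃] {a b : ℝ}

/-- Increments dominated by those of two absolutely continuous functions have small sums whenever
the latter do. This serves both vector-valued primitives and products. -/
theorem AbsolutelyContinuousOnInterval.of_dist_le {X Y Z : Type*} [PseudoMetricSpace X]
    [PseudoMetricSpace Y] [PseudoMetricSpace Z] {f : ℝ → X} {g : ℝ → Y} {h : ℝ → Z} {C D : ℝ}
    (hg : AbsolutelyContinuousOnInterval g a b) (hh : AbsolutelyContinuousOnInterval h a b)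
    (H : ∀ x ∈ uIcc a b, ∀ y ∈ uIcc a b,
      dist (f x) (f y) ≤ C * dist (g x) (g y) + D * dist (h x) (h y)) :
    AbsolutelyContinuousOnInterval f a b := by
  unfold AbsolutelyContinuousOnInterval at hg hh ⊢
  apply squeeze_zero' ?_ ?_ (by simpa using (hg.const_mul C).add (hh.const_mul D))
  · exact Filter.Eventually.of_forall fun _ => Finset.sum_nonneg fun i _ => dist_nonneg
  · rw [Filter.eventually_inf_principal]
    refine Filter.Eventually.of_forall fun E hE => ?_
    simp only [Finset.mul_sum, ← Finset.sum_add_distrib]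
    exact Finset.sum_le_sum fun i hi => H _ (hE.1 i hi).1 _ (hE.1 i hi).2

/-- Increments are dominated by those of the scalar primitive of `‖g‖`, so the real-valued case
suffices. -/
theorem IntervalIntegrable.absolutelyContinuousOnInterval_primitive [CompleteSpace F]
    {g : ℝ → F} {c : ℝ} (hg : IntervalIntegrable g volume a b) (hc : c ∈ uIcc a b) :
    AbsolutelyContinuousOnInterval (fun x => ∫ t in c..x, g t) a b := by
  have hn := hg.norm.absolutelyContinuousOnInterval_intervalIntegral hc
  have hi : ∀ x ∈ uIcc a b, ∀ y ∈ uIcc a b, IntervalIntegrable g volume x y := fun x hx y hy =>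
    hg.mono_set (uIcc_subset_uIcc hx hy)
  refine hn.of_dist_le (C := 1) (D := 0) hn fun x hx y hy => ?_
  rw [dist_eq_norm, dist_eq_norm, zero_mul, add_zero, one_mul,
    intervalIntegral.integral_interval_sub_left (hi c hc x hx) (hi c hc y hy),
    intervalIntegral.integral_interval_sub_left (hi c hc x hx).norm (hi c hc y hy).norm]
  exact intervalIntegral.norm_integral_le_abs_integral_norm

/-- `u` is absolutely continuous on `[a, b]` with integrable almost everywhere derivative `g`. -/
structure HasACDeriv (u g : ℝ → F) (a b : ℝ) : Prop where
  ac : AbsolutelyContinuousOnInterval u a b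
  integrable : IntervalIntegrable g volume a b
  deriv : ∀ᵐ x, x ∈ uIcc a b → HasDerivAt u (g x) x

namespace HasACDeriv

theorem continuousOn {u g : ℝ → F} (h : HasACDeriv u g a b) : ContinuousOn u (uIcc a b) :=
  h.ac.continuousOn

theorem primitive [CompleteSpace F] {g : ℝ → F} (hg : IntervalIntegrable g volume a b) :
    HasACDeriv (fun x => ∫ t in a..x, g t) g a b :=
  ⟨hg.absolutelyContinuousOnInterval_primitive left_mem_uIcc, hg,
    hg.ae_hasDerivAt_integral.mono fun _ hx hxm => hx hxm a left_mem_uIcc⟩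

theorem add {u v g h : ℝ → F} (hu : HasACDeriv u g a b) (hv : HasACDeriv v h a b) :
    HasACDeriv (u + v) (g + h) a b :=
  ⟨hu.ac.add hv.ac, hu.integrable.add hv.integrable,
    (hu.deriv.and hv.deriv).mono fun _ hx hm => (hx.1 hm).add (hx.2 hm)⟩

theorem sub {u v g h : ℝ → F} (hu : HasACDeriv u g a b) (hv : HasACDeriv v h a b) :
    HasACDeriv (u - v) (g - h) a b :=
  ⟨hu.ac.sub hv.ac, hu.integrable.sub hv.integrable,
    (hu.deriv.and hv.deriv).mono fun _ hx hm => (hx.1 hm).sub (hx.2 hm)⟩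

theorem of_contDiff {u : ℝ → F} (hu : ContDiff ℝ 1 u) : HasACDeriv u (_root_.deriv u) a b :=
  ⟨hu.contDiffOn.absolutelyContinuousOnInterval,
    (hu.continuous_deriv le_rfl).intervalIntegrable _ _,
    Filter.Eventually.of_forall fun x _ => (hu.differentiable one_ne_zero x).hasDerivAt⟩

theorem const (c : F) : HasACDeriv (fun _ => c) 0 a b := by
  have := of_contDiff (a := a) (b := b) (contDiff_const (𝕜 := ℝ) (E := ℝ) (c := c))
  rwa [show _root_.deriv (fun _ : ℝ => c) = 0 from funext fun x => by simp] at this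

/-- The fundamental theorem of calculus. -/
theorem integral_eq_sub [CompleteSpace F] {u g : ℝ → F} (h : HasACDeriv u g a b) :
    ∫ x in a..b, g x = u b - u a := by
  -- The difference from the primitive of `g` is absolutely continuous with derivative zero almost
  -- everywhere, hence constant.
  have hk := h.sub (primitive h.integrable)
  obtain ⟨C, hC⟩ := hk.ac.const_of_ae_hasDerivAt_zero (hk.deriv.mono fun x hx hm => by
    simpa using hx hm)
  have h₁ := hC a left_mem_uIcc
  have h₂ := hC b right_mem_uIcc
  simp only [Pi.sub_apply, intervalIntegral.integral_same, sub_zero] at h₁ h₂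
  rw [h₁, ← h₂]
  abel

/-- The product rule. -/
theorem bilinear {B : F₁ × F₂ → F₃} (hB : IsBoundedBilinearMap ℝ B) {u g : ℝ → F₁} {v h : ℝ → F₂}
    (hu : HasACDeriv u g a b) (hv : HasACDeriv v h a b) :
    HasACDeriv (fun x => B (u x, v x)) (fun x => B (g x, v x) + B (u x, h x)) a b := by
  obtain ⟨K, hK, hKB⟩ := hB.bound
  obtain ⟨C, hC⟩ := hu.ac.exists_bound
  obtain ⟨D, hD⟩ := hv.ac.exists_bound
  refine ⟨hu.ac.of_dist_le (C := K * D) (D := K * C) hv.ac fun x hx y hy => ?_, ?_, ?_⟩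
  -- The usual splitting of a product increment; the bounds on `u` and `v` supply the two constants.
  · have e : B (u x, v x) - B (u y, v y) = B (u x - u y, v x) + B (u y, v x - v y) := by
      rw [hB.map_sub_left, hB.map_sub_right]
      abel
    rw [dist_eq_norm, dist_eq_norm, dist_eq_norm, e]
    refine (norm_add_le _ _).trans (add_le_add ?_ ?_)
    · refine (hKB _ _).trans ?_
      nlinarith [hD x hx, norm_nonneg (u x - u y), mul_le_mul_of_nonneg_left (hD x hx)
        (mul_nonneg hK.le (norm_nonneg (u x - u y)))]
    · refine (hKB _ _).trans ?_
      exact mul_le_mul_of_nonneg_right (mul_le_mul_of_nonneg_left (hC y hy) hK.le) (norm_nonneg _)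
  · have key : ∀ {p : ℝ → F₁} {q : ℝ → F₂}, AEStronglyMeasurable p (volume.restrict (uIoc a b)) →
        AEStronglyMeasurable q (volume.restrict (uIoc a b)) →
        AEStronglyMeasurable (fun x => B (p x, q x)) (volume.restrict (uIoc a b)) := fun hp hq =>
      hB.continuous.comp_aestronglyMeasurable (hp.prodMk hq)
    have hum : AEStronglyMeasurable u (volume.restrict (uIoc a b)) :=
      (hu.continuousOn.mono uIoc_subset_uIcc).aestronglyMeasurable measurableSet_uIoc
    have hvm : AEStronglyMeasurable v (volume.restrict (uIoc a b)) :=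
      (hv.continuousOn.mono uIoc_subset_uIcc).aestronglyMeasurable measurableSet_uIoc
    refine IntervalIntegrable.add ?_ ?_
    · refine (hu.integrable.norm.const_mul (K * D)).mono_fun
        (key hu.integrable.aestronglyMeasurable_restrict_uIoc hvm) ?_
      filter_upwards [ae_restrict_mem measurableSet_uIoc] with x hx
      refine (hKB _ _).trans ((?_ : _ ≤ K * D * ‖g x‖).trans (le_abs_self _))
      calc K * ‖g x‖ * ‖v x‖ ≤ K * ‖g x‖ * D :=
            mul_le_mul_of_nonneg_left (hD x (uIoc_subset_uIcc hx)) (by positivity)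
        _ = K * D * ‖g x‖ := by ring
    · refine (hv.integrable.norm.const_mul (K * C)).mono_fun
        (key hum hv.integrable.aestronglyMeasurable_restrict_uIoc) ?_
      filter_upwards [ae_restrict_mem measurableSet_uIoc] with x hx
      refine (hKB _ _).trans ((?_ : _ ≤ K * C * ‖h x‖).trans (le_abs_self _))
      exact mul_le_mul_of_nonneg_right
        (mul_le_mul_of_nonneg_left (hC x (uIoc_subset_uIcc hx)) hK.le) (norm_nonneg _)
  · filter_upwards [hu.deriv, hv.deriv] with x h₁ h₂ hm
    have := (hB.hasFDerivAt (u x, v x)).comp_hasDerivAt x ((h₁ hm).prodMk (h₂ hm))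
    simpa [add_comm, Function.comp_def] using this

end HasACDeriv

end AbsolutelyContinuous

/-! ### Test functions on an open interval. -/

namespace QuantumGraph

/-- Test functions on `(0, L)`. -/
structure IsTest (L : ℝ) (φ : ℝ → ℝ) : Prop where
  contDiff : ContDiff ℝ ∞ φ
  hasCompactSupport : HasCompactSupport φ
  tsupport_subset : tsupport φ ⊆ Ioo 0 L

namespace IsTest

variable {L : ℝ} {φ ψ : ℝ → ℝ}

theorem continuous (hφ : IsTest L φ) : Continuous φ := hφ.contDiff.continuous

theorem eq_zero (hφ : IsTest L φ) {x : ℝ} (hx : x ∉ Ioo 0 L) : φ x = 0 :=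
  image_eq_zero_of_notMem_tsupport fun h => hx (hφ.tsupport_subset h)

theorem deriv (hφ : IsTest L φ) : IsTest L (deriv φ) :=
  ⟨hφ.contDiff.deriv' , hφ.hasCompactSupport.deriv,
    tsupport_deriv_subset.trans hφ.tsupport_subset⟩

theorem integrable (hφ : IsTest L φ) : Integrable φ :=
  hφ.continuous.integrable_of_hasCompactSupport hφ.hasCompactSupport

theorem sub_smul (hφ : IsTest L φ) (hψ : IsTest L ψ) (c : ℝ) :
    IsTest L (fun x => φ x - c * ψ x) := by
  have hs : tsupport (fun x => φ x - c * ψ x) ⊆ tsupport φ ∪ tsupport ψ := by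
    refine closure_minimal (fun x hx => ?_) ((isClosed_tsupport φ).union (isClosed_tsupport ψ))
    by_contra h
    rw [mem_union, not_or] at h
    exact hx (by simp [image_eq_zero_of_notMem_tsupport h.1, image_eq_zero_of_notMem_tsupport h.2])
  refine ⟨hφ.contDiff.sub (contDiff_const.mul hψ.contDiff), ?_,
    hs.trans (union_subset hφ.tsupport_subset hψ.tsupport_subset)⟩
  exact (hφ.hasCompactSupport.isCompact.union hψ.hasCompactSupport.isCompact).of_isClosed_subset
    (isClosed_tsupport _) hs

/-- The primitive from `0` vanishes to the left of the support, and also to the right of it because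
the total integral is zero. -/
theorem exists_primitive (hL : 0 < L) (hφ : IsTest L φ) (h0 : ∫ x, φ x = 0) :
    ∃ Φ, IsTest L Φ ∧ _root_.deriv Φ = φ := by
  obtain ⟨a, b, ha, hb, hab⟩ : ∃ a b, 0 < a ∧ b < L ∧ tsupport φ ⊆ Icc a b := by
    rcases (tsupport φ).eq_empty_or_nonempty with h | h
    -- For empty support, the endpoints are in reversed order, so `Icc a b` is empty.
    · exact ⟨L, 0, hL, hL, by simp [h]⟩
    · have hc : IsCompact (tsupport φ) := hφ.hasCompactSupport
      obtain ⟨a, ha⟩ := hc.exists_isLeast h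
      obtain ⟨b, hb⟩ := hc.exists_isGreatest h
      exact ⟨a, b, (hφ.tsupport_subset ha.1).1, (hφ.tsupport_subset hb.1).2,
        fun x hx => ⟨ha.2 hx, hb.2 hx⟩⟩
  have hz : ∀ x, x ∉ Icc a b → φ x = 0 := fun x hx =>
    image_eq_zero_of_notMem_tsupport fun h => hx (hab h)
  have hi : ∀ x y, IntervalIntegrable φ volume x y := fun x y =>
    hφ.continuous.intervalIntegrable x y
  have hd : ∀ x, HasDerivAt (fun x => ∫ t in (0 : ℝ)..x, φ t) (φ x) x := fun x =>
    hφ.continuous.integral_hasStrictDerivAt 0 x |>.hasDerivAt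
  have hd' : _root_.deriv (fun x => ∫ t in (0 : ℝ)..x, φ t) = φ := funext fun x => (hd x).deriv
  have hleft : ∀ x < a, ∫ t in (0 : ℝ)..x, φ t = 0 := fun x hx =>
    intervalIntegral.integral_zero_ae (Filter.Eventually.of_forall fun t ht => hz t fun h => by
      rcases le_total 0 x with h0 | h0
      · rw [uIoc_of_le h0] at ht
        linarith [ht.2, h.1]
      · rw [uIoc_of_ge h0] at ht
        linarith [ht.2, h.1])
  have hright : ∀ x, b < x → ∫ t in (0 : ℝ)..x, φ t = 0 := fun x hx => by
    rcases lt_or_ge x a with hxa | hxa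
    · exact hleft x hxa
    rw [intervalIntegral.integral_of_le (ha.le.trans hxa)]
    refine Eq.trans (setIntegral_eq_integral_of_forall_compl_eq_zero fun t ht => ?_) h0
    exact hz t fun h => ht ⟨lt_of_lt_of_le ha h.1, h.2.trans hx.le⟩
  have hs : tsupport (fun x => ∫ t in (0 : ℝ)..x, φ t) ⊆ Icc a b := by
    refine closure_minimal (fun x hx => ?_) isClosed_Icc
    by_contra h
    rw [mem_Icc, not_and_or, not_le, not_le] at h
    exact hx (h.elim (hleft x) (hright x))
  refine ⟨fun x => ∫ t in (0 : ℝ)..x, φ t, ⟨?_, ?_, hs.trans (Icc_subset_Ioo ha hb)⟩, hd'⟩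
  · rw [contDiff_infty_iff_deriv, hd']
    exact ⟨fun x => (hd x).differentiableAt, hφ.contDiff⟩
  · exact isCompact_Icc.of_isClosed_subset (isClosed_tsupport _) hs

theorem exists_integral_eq_one (hL : 0 < L) : ∃ χ, IsTest L χ ∧ ∫ x, χ x = 1 := by
  let B : ContDiffBump (L / 2) := ⟨L / 8, L / 4, by positivity, by linarith⟩
  refine ⟨B.normed volume, ⟨B.contDiff_normed, B.hasCompactSupport_normed, ?_⟩, B.integral_normed⟩
  rw [B.tsupport_normed_eq, Real.closedBall_eq_Icc]
  refine Icc_subset_Ioo ?_ ?_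
  · change 0 < L / 2 - L / 4
    linarith
  · change L / 2 + L / 4 < L
    linarith

end IsTest

/-! ### Weak derivatives, absolutely continuous representatives and regularity. -/

section Sobolev

variable {L : ℝ}

theorem EdgeL2.integrable (f : EdgeL2 L) : Integrable f (edgeMeasure L) :=
  (Lp.memLp f).integrable (by norm_num)

theorem intervalIntegrable_of_edge {u : ℝ → Spinor} (hL : 0 < L) (hu : Integrable u
    (edgeMeasure L)) :
    IntervalIntegrable u volume 0 L := by
  rw [intervalIntegrable_iff_integrableOn_Ioo_of_le hL.le]
  exact hu

theorem integral_edge {X : Type*} [NormedAddCommGroup X] [NormedSpace ℝ X] (hL : 0 < L)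
    (u : ℝ → X) : ∫ x, u x ∂(edgeMeasure L) = ∫ x in (0 : ℝ)..L, u x := by
  rw [intervalIntegral.integral_of_le hL.le, integral_Ioc_eq_integral_Ioo]

theorem memLp_of_continuousOn {u : ℝ → Spinor} (hu : ContinuousOn u (Icc 0 L)) :
    MemLp u 2 (edgeMeasure L) := by
  obtain ⟨C, hC⟩ := isCompact_Icc.exists_bound_of_continuousOn hu
  refine MemLp.of_bound ((hu.mono Ioo_subset_Icc_self).aestronglyMeasurable measurableSet_Ioo) C ?_
  filter_upwards [ae_restrict_mem measurableSet_Ioo] with x hx using hC x (Ioo_subset_Icc_self hx)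

/-- Two functions with the same integrals against test functions agree. -/
theorem ae_eq_of_integral_test {u v : ℝ → Spinor} (hu : Integrable u (edgeMeasure L))
    (hv : Integrable v (edgeMeasure L))
    (h : ∀ φ, IsTest L φ →
      ∫ x, φ x • u x ∂(edgeMeasure L) = ∫ x, φ x • v x ∂(edgeMeasure L)) :
    u =ᵐ[edgeMeasure L] v := by
  have key : ∀ᵐ x, x ∈ Ioo (0 : ℝ) L → u x - v x = 0 := by
    apply isOpen_Ioo.ae_eq_zero_of_integral_contDiff_smul_eq_zero
    · exact IntegrableOn.locallyIntegrableOn (hu.sub hv)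
    · intro φ hφ hc hs
      have ht : IsTest L φ := ⟨hφ, hc, hs⟩
      rw [← setIntegral_eq_integral_of_forall_compl_eq_zero (s := Ioo 0 L) fun x hx => by
        rw [ht.eq_zero hx, zero_smul]]
      obtain ⟨C, hC⟩ := hc.exists_bound_of_continuous hφ.continuous
      have hi : ∀ {w : ℝ → Spinor}, Integrable w (edgeMeasure L) →
          Integrable (fun x => φ x • w x) (edgeMeasure L) := fun hw =>
        hw.bdd_smul C hφ.continuous.aestronglyMeasurable (Filter.Eventually.of_forall hC)
      simp only [smul_sub]
      rw [integral_sub (hi hu) (hi hv), sub_eq_zero]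
      exact h φ ht
  have := (ae_restrict_iff' (μ := volume) measurableSet_Ioo).2 key
  filter_upwards [this] with x hx using sub_eq_zero.1 hx

theorem IsTest.integrable_smul {φ : ℝ → ℝ} (hφ : IsTest L φ) (f : EdgeL2 L) :
    Integrable (fun x => φ x • f x) (edgeMeasure L) :=
  integrable_smul_edge hφ.continuous hφ.hasCompactSupport f

/-- A functional on test functions that kills all derivatives is a multiple of the integral. -/
theorem integral_test_smul_eq (hL : 0 < L) {f : EdgeL2 L} {χ : ℝ → ℝ} (hχ : IsTest L χ)
    (hχ1 : ∫ x, χ x = 1) {D : (ℝ → ℝ) → ℝ → ℝ}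
    (hD : ∀ φ, IsTest L φ → IsTest L (D φ))
    (hsub : ∀ φ ψ c, IsTest L φ → IsTest L ψ →
      D (fun x => φ x - c * ψ x) = fun x => D φ x - c * D ψ x)
    (h : ∀ φ, IsTest L φ → ∫ x, D (deriv φ) x • f x ∂(edgeMeasure L) = 0)
    {φ : ℝ → ℝ} (hφ : IsTest L φ) :
    ∫ x, D φ x • f x ∂(edgeMeasure L)
      = ∫ x, φ x • (∫ y, D χ y • f y ∂(edgeMeasure L)) ∂(edgeMeasure L) := by
  have hφi : ∫ x, φ x ∂(edgeMeasure L) = ∫ x, φ x :=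
    setIntegral_eq_integral_of_forall_compl_eq_zero fun x hx => hφ.eq_zero hx
  -- Subtracting `(∫ φ) χ` leaves mean zero, hence a derivative of a test function, which the
  -- functional kills. The operator `D` will be `id` for constancy and `deriv` for affinity.
  obtain ⟨Φ, hΦ, hΦd⟩ := (hφ.sub_smul hχ (∫ x, φ x)).exists_primitive hL (by
    rw [integral_sub hφ.integrable (hχ.integrable.const_mul _), integral_const_mul, hχ1, mul_one,
      sub_self])
  have := h Φ hΦ
  rw [hΦd, hsub _ _ _ hφ hχ] at this
  simp only [sub_smul, mul_smul] at this
  have hi : Integrable (fun x => (∫ x, φ x) • D χ x • f x) (edgeMeasure L) :=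
    ((hD _ hχ).integrable_smul f).smul (∫ x, φ x)
  rw [integral_sub ((hD _ hφ).integrable_smul f) hi,
    integral_smul, sub_eq_zero] at this
  rw [this, integral_smul_const, hφi]

/-- The lemma of du Bois-Reymond. -/
theorem IsWeakDeriv.ae_eq_const (hL : 0 < L) {f : EdgeL2 L} (h : IsWeakDeriv f 0) :
    ∃ c : Spinor, f =ᵐ[edgeMeasure L] fun _ => c := by
  obtain ⟨χ, hχ, hχ1⟩ := IsTest.exists_integral_eq_one hL
  refine ⟨_, ae_eq_of_integral_test f.integrable (integrable_const _) fun φ hφ =>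
    integral_test_smul_eq hL hχ hχ1 (D := id) (fun _ h => h) (fun _ _ _ _ _ => rfl)
      (fun φ hφ => ?_) hφ⟩
  refine (h φ hφ.contDiff hφ.hasCompactSupport hφ.tsupport_subset).trans ?_
  rw [neg_eq_zero, ← integral_zero ℝ Spinor (μ := edgeMeasure L)]
  apply integral_congr_ae
  filter_upwards [Lp.coeFn_zero Spinor 2 (edgeMeasure L)] with x hx
  rw [hx]
  simp

/-- The class of a function that is continuous on `[0, L]`. -/
noncomputable def edgeOf (u : ℝ → Spinor) (hu : ContinuousOn u (Icc 0 L)) : EdgeL2 L :=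
  (memLp_of_continuousOn hu).toLp u

theorem coeFn_edgeOf {u : ℝ → Spinor} (hu : ContinuousOn u (Icc 0 L)) :
    edgeOf u hu =ᵐ[edgeMeasure L] u :=
  MemLp.coeFn_toLp _

/-- A function without second weak derivative is affine. -/
theorem exists_isWeakDeriv_const (hL : 0 < L) {f : EdgeL2 L}
    (h : ∀ φ, IsTest L φ → ∫ x, deriv (deriv φ) x • f x ∂(edgeMeasure L) = 0) :
    ∃ c : Spinor, IsWeakDeriv f (edgeOf (fun _ => c) continuousOn_const) := by
  obtain ⟨χ, hχ, hχ1⟩ := IsTest.exists_integral_eq_one hL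
  refine ⟨-∫ y, deriv χ y • f y ∂(edgeMeasure L), fun φ h₁ h₂ h₃ => ?_⟩
  have hφ : IsTest L φ := ⟨h₁, h₂, h₃⟩
  refine (integral_test_smul_eq hL hχ hχ1 (fun _ => IsTest.deriv) (fun φ ψ c hφ hψ => ?_) h
    hφ).trans ?_
  · funext x
    have h₁ := (hφ.contDiff.differentiable (by simp) x).hasDerivAt
    have h₂ := (hψ.contDiff.differentiable (by simp) x).hasDerivAt
    exact (h₁.sub (h₂.const_mul c)).deriv
  · rw [← integral_neg]
    apply integral_congr_ae
    filter_upwards [coeFn_edgeOf (L := L) (u := fun _ => -∫ y, deriv χ y • f y ∂(edgeMeasure L))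
      continuousOn_const] with x hx
    rw [hx, smul_neg, neg_neg]

/-- The product `φ • u` is absolutely continuous and vanishes at both ends, so its derivative
integrates to zero. -/
theorem _root_.HasACDeriv.isWeakDeriv (hL : 0 < L) {u v : ℝ → Spinor} (h : HasACDeriv u v 0 L)
    {f g : EdgeL2 L} (hf : f =ᵐ[edgeMeasure L] u) (hg : g =ᵐ[edgeMeasure L] v) :
    IsWeakDeriv f g := by
  intro φ h₁ h₂ h₃
  have hφ : IsTest L φ := ⟨h₁, h₂, h₃⟩
  have hp := ((HasACDeriv.of_contDiff (hφ.contDiff.of_le (by simp))).bilinear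
    isBoundedBilinearMap_smul h).integral_eq_sub
  simp only at hp
  rw [hφ.eq_zero (by simp), hφ.eq_zero (by simp), zero_smul, zero_smul, sub_self,
    ← integral_edge hL] at hp
  rw [← add_eq_zero_iff_eq_neg, ← hp, ← integral_add (hφ.deriv.integrable_smul f)
    (hφ.integrable_smul g)]
  apply integral_congr_ae
  filter_upwards [hf, hg] with x hx hx'
  rw [hx, hx']

theorem exists_isWeakDeriv (hL : 0 < L) (g : EdgeL2 L) : ∃ (k : EdgeL2 L) (u : ℝ → Spinor),
    IsWeakDeriv k g ∧ k =ᵐ[edgeMeasure L] u ∧ HasACDeriv u g 0 L := by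
  have h := HasACDeriv.primitive (intervalIntegrable_of_edge hL g.integrable)
  have hc := h.continuousOn
  rw [uIcc_of_le hL.le] at hc
  exact ⟨edgeOf _ hc, _, h.isWeakDeriv hL (coeFn_edgeOf hc) Filter.EventuallyEq.rfl,
    coeFn_edgeOf hc, h⟩

theorem IsWeakDeriv.neg {f g : EdgeL2 L} (h : IsWeakDeriv f g) : IsWeakDeriv (-f) (-g) := by
  simpa using h.smul (-1)

theorem IsWeakDeriv.sub {f g f' g' : EdgeL2 L} (h : IsWeakDeriv f g) (h' : IsWeakDeriv f' g') :
    IsWeakDeriv (f - f') (g - g') := by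
  simpa [sub_eq_add_neg] using h.add h'.neg

/-- Elements of `W^{1,2}` are absolutely continuous. -/
theorem IsWeakDeriv.exists_hasACDeriv (hL : 0 < L) {f g : EdgeL2 L} (h : IsWeakDeriv f g) :
    ∃ u : ℝ → Spinor, HasACDeriv u g 0 L ∧ f =ᵐ[edgeMeasure L] u := by
  obtain ⟨k, u, hk, hku, hu⟩ := exists_isWeakDeriv hL g
  -- The primitive `k` of `g` has the same weak derivative as `f`, so only a constant separates
  -- them.
  obtain ⟨c, hc⟩ := IsWeakDeriv.ae_eq_const hL (f := f - k) (by simpa using h.sub hk)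
  refine ⟨_, by simpa using hu.add (HasACDeriv.const c), ?_⟩
  filter_upwards [hc, hku, Lp.coeFn_sub f k] with x h₁ h₂ h₃
  rw [h₃, Pi.sub_apply, sub_eq_iff_eq_add] at h₁
  rw [h₁, h₂, Pi.add_apply, add_comm]

/-- Interior regularity: a distributional solution of `f'' = b - a'` is in `W^{1,2}`. -/
theorem exists_isWeakDeriv_of_second (hL : 0 < L) {f a b : EdgeL2 L}
    (h : ∀ φ, IsTest L φ → ∫ x, deriv (deriv φ) x • f x ∂(edgeMeasure L)
      = ∫ x, deriv φ x • a x ∂(edgeMeasure L) + ∫ x, φ x • b x ∂(edgeMeasure L)) :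
    ∃ g : EdgeL2 L, IsWeakDeriv f (g - a) ∧ IsWeakDeriv g b := by
  -- With `b₁' = b` and `k' = a - b₁`, the second distributional derivative of `f + k` is zero. Thus
  -- `f' = c - (a - b₁)` for a constant `c`, and `g = c + b₁` is the witness.
  obtain ⟨b₁, -, hb, -, -⟩ := exists_isWeakDeriv hL b
  obtain ⟨k, -, hk, -, -⟩ := exists_isWeakDeriv hL (a - b₁)
  have hint : ∀ (p q : EdgeL2 L) {φ : ℝ → ℝ}, IsTest L φ →
      ∫ x, φ x • (p + q : EdgeL2 L) x ∂(edgeMeasure L)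
        = ∫ x, φ x • p x ∂(edgeMeasure L) + ∫ x, φ x • q x ∂(edgeMeasure L) := by
    intro p q φ hφ
    rw [← integral_add (hφ.integrable_smul p) (hφ.integrable_smul q)]
    apply integral_congr_ae
    filter_upwards [Lp.coeFn_add p q] with x hx
    rw [hx, Pi.add_apply, smul_add]
  obtain ⟨c, hc⟩ := exists_isWeakDeriv_const hL (f := f + k) fun φ hφ => by
    have e₁ := hk _ hφ.deriv.contDiff hφ.deriv.hasCompactSupport hφ.deriv.tsupport_subset
    have e₂ := hb φ hφ.contDiff hφ.hasCompactSupport hφ.tsupport_subset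
    have e₃ := hint (a - b₁) b₁ hφ.deriv
    rw [sub_add_cancel] at e₃
    rw [hint f k hφ.deriv.deriv, h φ hφ, e₁, e₃, e₂]
    abel
  refine ⟨edgeOf (fun _ => c) continuousOn_const + b₁, ?_, ?_⟩
  · have := hc.sub hk
    rw [add_sub_cancel_right] at this
    convert this using 1
    abel
  · have h0 : IsWeakDeriv (edgeOf (L := L) (fun _ => c) continuousOn_const) 0 :=
      (HasACDeriv.const c).isWeakDeriv hL (coeFn_edgeOf _) (Lp.coeFn_zero _ _ _)
    simpa using h0.add hb

/-- Continuous functions that agree almost everywhere on a nondegenerate interval agree on its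
closure, endpoints included. -/
theorem HasValueAt.unique (hL : 0 < L) {f : EdgeL2 L} {x : ℝ} (hx : x ∈ Icc 0 L) {y z : Spinor}
    (hy : HasValueAt f x y) (hz : HasValueAt f x z) : y = z := by
  obtain ⟨u, hu, hfu, rfl⟩ := hy
  obtain ⟨v, hv, hfv, rfl⟩ := hz
  have h : u =ᵐ[volume.restrict (Icc 0 L)] v := by
    rw [← Measure.restrict_congr_set Ioo_ae_eq_Icc]
    exact hfu.symm.trans hfv
  exact Measure.eqOn_Icc_of_ae_eq _ hL.ne h hu hv hx

end Sobolev

/-! ### Green's formula on one edge. -/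

section Green

variable {L : ℝ} {M : Matrix (Fin 2) (Fin 2) ℂ}

theorem coeFn_matAct (M : Matrix (Fin 2) (Fin 2) ℂ) (f : EdgeL2 L) :
    matAct M f =ᵐ[edgeMeasure L] fun x => Matrix.toEuclideanCLM (n := Fin 2) (𝕜 := ℂ) M (f x) :=
  ContinuousLinearMap.coeFn_compLpL _ _

theorem inner_toEuclideanCLM (hM : M.IsHermitian) (x y : Spinor) :
    ⟪Matrix.toEuclideanCLM (n := Fin 2) (𝕜 := ℂ) M x, y⟫_ℂ
      = ⟪x, Matrix.toEuclideanCLM (n := Fin 2) (𝕜 := ℂ) M y⟫_ℂ := by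
  have h : star (Matrix.toEuclideanCLM (n := Fin 2) (𝕜 := ℂ) M)
      = Matrix.toEuclideanCLM (n := Fin 2) (𝕜 := ℂ) M := by
    rw [← map_star]
    exact congrArg _ hM
  nth_rw 1 [← h]
  exact ContinuousLinearMap.adjoint_inner_left _ _ _

theorem inner_matAct (hM : M.IsHermitian) (f g : EdgeL2 L) :
    ⟪matAct M f, g⟫_ℂ = ⟪f, matAct M g⟫_ℂ := by
  rw [L2.inner_def, L2.inner_def]
  apply integral_congr_ae
  filter_upwards [coeFn_matAct M f, coeFn_matAct M g] with x h₁ h₂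
  rw [h₁, h₂, inner_toEuclideanCLM hM]

theorem isHermitian_edgePotential (d : EuclideanSpace ℝ (Fin 2)) (a kR : ℝ) :
    (edgePotential d a kR).IsHermitian := by
  ext i j
  fin_cases i <;> fin_cases j <;>
    simp [edgePotential, sigmaMatrix, Matrix.conjTranspose_apply, sub_eq_add_neg]

theorem HasValueAt.eq_apply (hL : 0 < L) {f : EdgeL2 L} {x : ℝ} (hx : x ∈ Icc 0 L) {y : Spinor}
    {u v : ℝ → Spinor} (hu : HasACDeriv u v 0 L) (hfu : f =ᵐ[edgeMeasure L] u)
    (hy : HasValueAt f x y) : y = u x := by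
  have hc := hu.continuousOn
  rw [uIcc_of_le hL.le] at hc
  exact hy.unique hL hx ⟨u, hc, hfu, rfl⟩

/-- Integration by parts in `W^{1,2}`. -/
theorem IsWeakDeriv.inner_add_inner (hL : 0 < L) {f f' g g' : EdgeL2 L} (hf : IsWeakDeriv f f')
    (hg : IsWeakDeriv g g') {y z y' z' : Spinor} (hy : HasValueAt f 0 y) (hz : HasValueAt f L z)
    (hy' : HasValueAt g 0 y') (hz' : HasValueAt g L z') :
    ⟪f', g⟫_ℂ + ⟪f, g'⟫_ℂ = ⟪z, z'⟫_ℂ - ⟪y, y'⟫_ℂ := by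
  obtain ⟨u, hu, hfu⟩ := hf.exists_hasACDeriv hL
  obtain ⟨v, hv, hgv⟩ := hg.exists_hasACDeriv hL
  have h0 : (0 : ℝ) ∈ Icc 0 L := left_mem_Icc.2 hL.le
  have h1 : L ∈ Icc 0 L := right_mem_Icc.2 hL.le
  have hp := (hu.bilinear (isBoundedBilinearMap_inner (𝕜 := ℂ)) hv).integral_eq_sub
  simp only at hp
  rw [hy.eq_apply hL h0 hu hfu, hz.eq_apply hL h1 hu hfu,
    hy'.eq_apply hL h0 hv hgv, hz'.eq_apply hL h1 hv hgv, ← hp, ← integral_edge hL,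
    L2.inner_def, L2.inner_def, ← integral_add (L2.integrable_inner _ _) (L2.integrable_inner _ _)]
  apply integral_congr_ae
  filter_upwards [hfu, hgv] with x h₁ h₂
  rw [h₁, h₂]

theorem exists_hasValueAt (hL : 0 < L) {f : EdgeL2 L} (hf : f ∈ SobolevOne L) (x : ℝ) :
    ∃ y, HasValueAt f x y := by
  obtain ⟨g, hg⟩ := hf
  obtain ⟨u, hu, hfu⟩ := hg.exists_hasACDeriv hL
  have hc := hu.continuousOn
  rw [uIcc_of_le hL.le] at hc
  exact ⟨_, u, hc, hfu, rfl⟩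

/-- The two terms containing `M` cancel since `iM` is skew-adjoint, leaving ordinary integration by
parts. -/
theorem covDeriv_inner_add_inner (hL : 0 < L) (hM : M.IsHermitian) {f g : EdgeL2 L}
    (hf : f ∈ SobolevOne L) (hg : g ∈ SobolevOne L) {y z y' z' : Spinor}
    (hy : HasValueAt f 0 y) (hz : HasValueAt f L z)
    (hy' : HasValueAt g 0 y') (hz' : HasValueAt g L z') :
    ⟪covDeriv M f, g⟫_ℂ + ⟪f, covDeriv M g⟫_ℂ = ⟪z, z'⟫_ℂ - ⟪y, y'⟫_ℂ := by
  obtain ⟨f', hf⟩ := hf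
  obtain ⟨g', hg⟩ := hg
  rw [← hf.inner_add_inner hL hg hy hz hy' hz', covDeriv, covDeriv, hf.weakDeriv_eq,
    hg.weakDeriv_eq, inner_sub_left, inner_sub_right, inner_smul_left, inner_smul_right,
    inner_matAct hM, Complex.conj_I]
  ring

theorem covDeriv_mem (M : Matrix (Fin 2) (Fin 2) ℂ) {f : EdgeL2 L} (hf : f ∈ SobolevTwo L) :
    covDeriv M f ∈ SobolevOne L := by
  obtain ⟨g, h, hg, hh⟩ := hf
  refine ⟨h - Complex.I • matAct M g, ?_⟩
  rw [covDeriv, hg.weakDeriv_eq]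
  exact hh.sub ((hg.map _).smul _)

theorem edgeMomentum_eq (M : Matrix (Fin 2) (Fin 2) ℂ) (f : EdgeL2 L) :
    edgeMomentum M f = Complex.I • covDeriv M f := by
  rw [edgeMomentum, covDeriv, smul_sub, smul_smul, Complex.I_mul_I, neg_one_smul, sub_neg_eq_add]

theorem edgeRashba_eq (d : EuclideanSpace ℝ (Fin 2)) (a kR : ℝ) {f : EdgeL2 L}
    (hf : f ∈ SobolevTwo L) :
    edgeRashba d a kR f = -covDeriv (edgePotential d a kR) (covDeriv (edgePotential d a kR) f)
      - ((kR : ℂ) ^ 2) • f := by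
  rw [edgeRashba, edgeMomentum_eq _ f, edgeMomentum_smul _ _ (covDeriv_mem _ hf), edgeMomentum_eq,
    smul_smul, Complex.I_mul_I, neg_one_smul]

/-- The boundary values `y, z` of `f` and `p, q` of its covariant derivative at the initial and at
the terminal end of an edge. -/
structure EdgeTraces (M : Matrix (Fin 2) (Fin 2) ℂ) (f : EdgeL2 L) (y z p q : Spinor) : Prop where
  mem : f ∈ SobolevTwo L
  left : HasValueAt f 0 y
  right : HasValueAt f L z
  covLeft : HasValueAt (covDeriv M f) 0 p
  covRight : HasValueAt (covDeriv M f) L q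

namespace EdgeTraces

variable {f g : EdgeL2 L} {y z p q y' z' p' q' : Spinor}

theorem add (h : EdgeTraces M f y z p q) (h' : EdgeTraces M g y' z' p' q') :
    EdgeTraces M (f + g) (y + y') (z + z') (p + p') (q + q') := by
  refine ⟨add_mem h.mem h'.mem, h.left.add h'.left, h.right.add h'.right, ?_, ?_⟩ <;>
    rw [covDeriv_add _ (SobolevTwo.le_one h.mem) (SobolevTwo.le_one h'.mem)]
  exacts [h.covLeft.add h'.covLeft, h.covRight.add h'.covRight]

theorem zero : EdgeTraces M (0 : EdgeL2 L) 0 0 0 0 := by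
  have h0 : covDeriv M (0 : EdgeL2 L) = 0 := by
    simpa using covDeriv_smul M 0 (SobolevOne L).zero_mem
  refine ⟨zero_mem _, HasValueAt.zero _, HasValueAt.zero _, ?_, ?_⟩ <;> rw [h0] <;>
    exact HasValueAt.zero _

theorem exists_of_mem (hL : 0 < L) (M : Matrix (Fin 2) (Fin 2) ℂ) (hf : f ∈ SobolevTwo L) :
    ∃ y z p q, EdgeTraces M f y z p q := by
  obtain ⟨y, hy⟩ := exists_hasValueAt hL (SobolevTwo.le_one hf) 0
  obtain ⟨z, hz⟩ := exists_hasValueAt hL (SobolevTwo.le_one hf) L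
  obtain ⟨p, hp⟩ := exists_hasValueAt hL (covDeriv_mem M hf) 0
  obtain ⟨q, hq⟩ := exists_hasValueAt hL (covDeriv_mem M hf) L
  exact ⟨y, z, p, q, hf, hy, hz, hp, hq⟩

/-- Green's formula for the covariant Laplacian. -/
theorem green (hL : 0 < L) (hM : M.IsHermitian) (h : EdgeTraces M f y z p q)
    (h' : EdgeTraces M g y' z' p' q') :
    ⟪covDeriv M (covDeriv M f), g⟫_ℂ - ⟪f, covDeriv M (covDeriv M g)⟫_ℂ
      = ⟪q, z'⟫_ℂ - ⟪p, y'⟫_ℂ - (⟪z, q'⟫_ℂ - ⟪y, p'⟫_ℂ) := by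
  -- Integrate by parts for the pairs `(Df, g)` and `(f, Dg)`; the common term `⟪Df, Dg⟫` cancels in
  -- the difference.
  rw [← covDeriv_inner_add_inner hL hM (covDeriv_mem M h.mem) (SobolevTwo.le_one h'.mem)
    h.covLeft h.covRight h'.left h'.right,
    ← covDeriv_inner_add_inner hL hM (SobolevTwo.le_one h.mem) (covDeriv_mem M h'.mem)
    h.left h.right h'.covLeft h'.covRight]
  ring

/-- Green's formula for the Rashba Hamiltonian of an edge. -/
theorem green_rashba (hL : 0 < L) {d : EuclideanSpace ℝ (Fin 2)} {a kR : ℝ}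
    (h : EdgeTraces (edgePotential d a kR) f y z p q)
    (h' : EdgeTraces (edgePotential d a kR) g y' z' p' q') :
    ⟪edgeRashba d a kR f, g⟫_ℂ - ⟪f, edgeRashba d a kR g⟫_ℂ
      = ⟪p, y'⟫_ℂ - ⟪q, z'⟫_ℂ - (⟪y, p'⟫_ℂ - ⟪z, q'⟫_ℂ) := by
  have hG := h.green hL (isHermitian_edgePotential d a kR) h'
  rw [edgeRashba_eq d a kR h.mem, edgeRashba_eq d a kR h'.mem, inner_sub_left, inner_sub_right,
    inner_neg_left, inner_neg_right, inner_smul_left, inner_smul_right, map_pow,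
    Complex.conj_ofReal]
  linear_combination -hG

end EdgeTraces

end Green

/-! ### Covariantly constant frames and cubic profiles. -/

section Smooth

variable {L : ℝ} {M : Matrix (Fin 2) (Fin 2) ℂ}

/-- The class of a smooth function. -/
noncomputable def smoothEdge (L : ℝ) (u : ℝ → Spinor) (hu : ContDiff ℝ ∞ u) : EdgeL2 L :=
  edgeOf u hu.continuous.continuousOn

theorem coeFn_smoothEdge {u : ℝ → Spinor} (hu : ContDiff ℝ ∞ u) :
    smoothEdge L u hu =ᵐ[edgeMeasure L] u :=
  coeFn_edgeOf _

theorem hasValueAt_smoothEdge {u : ℝ → Spinor} (hu : ContDiff ℝ ∞ u) (x : ℝ) :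
    HasValueAt (smoothEdge L u hu) x (u x) :=
  ⟨u, hu.continuous.continuousOn, coeFn_smoothEdge hu, rfl⟩

theorem isWeakDeriv_smoothEdge (hL : 0 < L) {u : ℝ → Spinor} (hu : ContDiff ℝ ∞ u) :
    IsWeakDeriv (smoothEdge L u hu) (smoothEdge L (deriv u) (contDiff_infty_iff_deriv.1 hu).2) :=
  (HasACDeriv.of_contDiff (hu.of_le (by simp))).isWeakDeriv hL (coeFn_smoothEdge _)
    (coeFn_smoothEdge _)

theorem smoothEdge_mem (hL : 0 < L) {u : ℝ → Spinor} (hu : ContDiff ℝ ∞ u) :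
    smoothEdge L u hu ∈ SobolevTwo L :=
  ⟨_, _, isWeakDeriv_smoothEdge hL hu, isWeakDeriv_smoothEdge hL _⟩

theorem covDeriv_smoothEdge (hL : 0 < L) {u v : ℝ → Spinor} (hu : ContDiff ℝ ∞ u)
    (hv : ContDiff ℝ ∞ v)
    (h : ∀ x, deriv u x - Complex.I • Matrix.toEuclideanCLM (n := Fin 2) (𝕜 := ℂ) M (u x) = v x) :
    covDeriv M (smoothEdge L u hu) = smoothEdge L v hv := by
  rw [covDeriv, (isWeakDeriv_smoothEdge hL hu).weakDeriv_eq]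
  apply Lp.ext
  refine (Lp.coeFn_sub _ _).trans ?_
  filter_upwards [coeFn_smoothEdge (L := L) (contDiff_infty_iff_deriv.1 hu).2,
    Lp.coeFn_smul Complex.I (matAct M (smoothEdge L u hu)), coeFn_matAct M (smoothEdge L u hu),
    coeFn_smoothEdge (L := L) hu, coeFn_smoothEdge (L := L) hv] with x h₁ h₂ h₃ h₄ h₅
  rw [Pi.sub_apply, h₁, h₂, Pi.smul_apply, h₃, h₄, h₅, h]

/-- The frame that is covariantly constant along the edge and equals `c` at `a`. -/
noncomputable def frame (M : Matrix (Fin 2) (Fin 2) ℂ) (a : ℝ) (c : Spinor) (x : ℝ) : Spinor :=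
  NormedSpace.exp ((x - a) • (Complex.I • Matrix.toEuclideanCLM (n := Fin 2) (𝕜 := ℂ) M)) c

@[simp]
theorem frame_self (M : Matrix (Fin 2) (Fin 2) ℂ) (a : ℝ) (c : Spinor) : frame M a c a = c := by
  have h : (a - a) • (Complex.I • Matrix.toEuclideanCLM (n := Fin 2) (𝕜 := ℂ) M) = 0 := by
    rw [sub_self]
    exact zero_smul ℝ (Complex.I • Matrix.toEuclideanCLM (n := Fin 2) (𝕜 := ℂ) M)
  rw [frame, h, NormedSpace.exp_zero, one_apply_eq_self]

theorem hasDerivAt_frame (M : Matrix (Fin 2) (Fin 2) ℂ) (a : ℝ) (c : Spinor) (x : ℝ) :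
    HasDerivAt (frame M a c)
      (Complex.I • Matrix.toEuclideanCLM (n := Fin 2) (𝕜 := ℂ) M (frame M a c x)) x := by
  set K : Spinor →L[ℂ] Spinor := Complex.I • Matrix.toEuclideanCLM (n := Fin 2) (𝕜 := ℂ) M with hK
  have h := (hasDerivAt_exp_smul_const' (𝕂 := ℝ) K (x - a)).comp_sub_const x a
  exact ((ContinuousLinearMap.apply ℂ Spinor c).restrictScalars ℝ).hasFDerivAt.comp_hasDerivAt x h

/-- Bootstrapping: the derivative is a constant linear map applied to the frame itself, so each
degree of smoothness yields the next. -/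
theorem contDiff_frame (M : Matrix (Fin 2) (Fin 2) ℂ) (a : ℝ) (c : Spinor) :
    ContDiff ℝ ∞ (frame M a c) := by
  have h : ∀ n : ℕ, ContDiff ℝ n (frame M a c) := by
    intro n
    induction n with
    | zero =>
      exact contDiff_zero.2 (continuous_iff_continuousAt.2 fun x =>
        (hasDerivAt_frame M a c x).continuousAt)
    | succ n ih =>
      rw [show ((n + 1 : ℕ) : WithTop ℕ∞) = (n : WithTop ℕ∞) + 1 from rfl, contDiff_succ_iff_deriv]
      refine ⟨fun x => (hasDerivAt_frame M a c x).differentiableAt,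
        by simp, ?_⟩
      rw [show deriv (frame M a c) = _ from funext fun x => (hasDerivAt_frame M a c x).deriv]
      exact ((Complex.I • Matrix.toEuclideanCLM (n := Fin 2)
          (𝕜 := ℂ) M).restrictScalars ℝ).contDiff.comp
        ih
  exact contDiff_infty.2 h

/-- The generator `iM` is skew-adjoint, so the squared norm has zero derivative. This keeps later
estimates independent of `M`. -/
theorem norm_frame (hM : M.IsHermitian) (a : ℝ) (c : Spinor) (x : ℝ) : ‖frame M a c x‖ = ‖c‖ := by
  set T := Matrix.toEuclideanCLM (n := Fin 2) (𝕜 := ℂ) M with hT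
  have hd : ∀ x, HasDerivAt (fun x => ⟪frame M a c x, frame M a c x⟫_ℂ) 0 x := fun x => by
    have h := (hasDerivAt_frame M a c x).inner ℂ (hasDerivAt_frame M a c x)
    rw [inner_smul_left, inner_smul_right, inner_toEuclideanCLM hM, Complex.conj_I] at h
    simpa using h
  have := is_const_of_deriv_eq_zero (fun x => (hd x).differentiableAt) (fun x => (hd x).deriv) x a
  simp only [inner_self_eq_norm_sq_to_K, frame_self] at this
  have h2 : ‖frame M a c x‖ ^ 2 = ‖c‖ ^ 2 := by exact_mod_cast this
  exact (sq_eq_sq₀ (norm_nonneg _) (norm_nonneg _)).1 h2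

theorem contDiff_smul_frame {η : ℝ → ℝ} (hη : ContDiff ℝ ∞ η) (M : Matrix (Fin 2) (Fin 2) ℂ)
    (a : ℝ) (c : Spinor) : ContDiff ℝ ∞ fun x => η x • frame M a c x :=
  hη.smul (contDiff_frame M a c)

/-- A profile times the covariantly constant frame. -/
noncomputable def profileEdge (L : ℝ) (M : Matrix (Fin 2) (Fin 2) ℂ) (a : ℝ) (c : Spinor)
    (η : ℝ → ℝ) (hη : ContDiff ℝ ∞ η) : EdgeL2 L :=
  smoothEdge L (fun x => η x • frame M a c x) (contDiff_smul_frame hη M a c)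

/-- The derivative of the frame is cancelled by the potential term of `D`, so only the profile is
differentiated. -/
theorem covDeriv_profileEdge (hL : 0 < L) (a : ℝ) (c : Spinor) {η : ℝ → ℝ}
    (hη : ContDiff ℝ ∞ η) :
    covDeriv M (profileEdge L M a c η hη)
      = profileEdge L M a c (deriv η) (contDiff_infty_iff_deriv.1 hη).2 := by
  refine covDeriv_smoothEdge hL _ _ fun x => ?_
  have h := (hη.differentiable (by simp) x).hasDerivAt.smul (hasDerivAt_frame M a c x)
  rw [show deriv (fun x => η x • frame M a c x) x = _ from h.deriv,
    ContinuousLinearMap.map_smul_of_tower, smul_comm Complex.I]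
  abel

theorem norm_profileEdge_le (hM : M.IsHermitian) (hL : 0 ≤ L) (a : ℝ) (c : Spinor) {η : ℝ → ℝ}
    (hη : ContDiff ℝ ∞ η) {K : ℝ} (hK : 0 ≤ K) (h : ∀ x ∈ Icc 0 L, |η x| ≤ K) :
    ‖profileEdge L M a c η hη‖ ≤ √L * (K * ‖c‖) := by
  refine (Lp.norm_le_of_ae_bound (C := K * ‖c‖) (by positivity) ?_).trans_eq ?_
  · filter_upwards [ae_restrict_mem measurableSet_Ioo,
      coeFn_smoothEdge (L := L) (contDiff_smul_frame hη M a c)] with x hx h'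
    rw [profileEdge, h', norm_smul, norm_frame hM]
    exact mul_le_mul_of_nonneg_right (h x (Ioo_subset_Icc_self hx)) (norm_nonneg _)
  · congr 1
    rw [Real.sqrt_eq_rpow]
    simp [measureUnivNNReal]
    rw [ENNReal.coe_toNNReal_eq_toReal, ENNReal.toReal_ofReal hL]

/-- A smooth profile on `[0, L]`, bounded by `K` together with its second derivative, with values
`y, z` and derivatives `p, q` at the ends. -/
structure IsProfile (L K : ℝ) (η : ℝ → ℝ) (y z p q : ℝ) : Prop where
  contDiff : ContDiff ℝ ∞ η
  left : η 0 = y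
  right : η L = z
  derivLeft : deriv η 0 = p
  derivRight : deriv η L = q
  bound : ∀ x ∈ Icc 0 L, |η x| ≤ K
  bound_deriv : ∀ x ∈ Icc 0 L, |deriv (deriv η) x| ≤ K

/-- Reflection transfers profiles built for the initial end to the terminal end, with a sign change
in the derivatives. -/
theorem IsProfile.reflect {K : ℝ} {η : ℝ → ℝ} {y z p q : ℝ} (h : IsProfile L K η y z p q) :
    IsProfile L K (fun x => η (L - x)) z y (-q) (-p) := by
  have hd : deriv (fun x => η (L - x)) = fun x => -deriv η (L - x) :=
    funext fun x => deriv_comp_const_sub ..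
  have hd' : deriv (fun x => -deriv η (L - x)) = fun x => deriv (deriv η) (L - x) :=
    funext fun x => by
      rw [deriv.fun_neg, deriv_comp_const_sub (f := deriv η), neg_neg]
  have hm : ∀ x ∈ Icc 0 L, L - x ∈ Icc 0 L := fun x hx =>
    ⟨by linarith [hx.2], by linarith [hx.1]⟩
  refine ⟨h.contDiff.comp (contDiff_const.sub contDiff_id), ?_, ?_, ?_, ?_,
    fun x hx => h.bound _ (hm x hx), fun x hx => ?_⟩
  · simp [h.right]
  · simp [h.left]
  · simp [hd, h.derivRight]
  · simp [hd, h.derivLeft]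
  · rw [hd, hd']
    exact h.bound_deriv _ (hm x hx)

theorem isProfile_cubic {K α β γ δ y z p q : ℝ} (hy : α = y)
    (hz : α + β * L + γ * L ^ 2 + δ * L ^ 3 = z) (hp : β = p)
    (hq : β + 2 * γ * L + 3 * δ * L ^ 2 = q)
    (hb : ∀ x ∈ Icc 0 L, |α + β * x + γ * x ^ 2 + δ * x ^ 3| ≤ K)
    (hb' : ∀ x ∈ Icc 0 L, |2 * γ + 6 * δ * x| ≤ K) :
    IsProfile L K (fun x => α + β * x + γ * x ^ 2 + δ * x ^ 3) y z p q := by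
  have hd : deriv (fun x : ℝ => α + β * x + γ * x ^ 2 + δ * x ^ 3)
      = fun x => β + 2 * γ * x + 3 * δ * x ^ 2 := funext fun x => by
    have h := ((((hasDerivAt_id x).const_mul β).const_add α).add
      ((hasDerivAt_pow 2 x).const_mul γ)).add ((hasDerivAt_pow 3 x).const_mul δ)
    refine h.deriv.trans ?_
    norm_num
    ring
  have hd' : deriv (fun x : ℝ => β + 2 * γ * x + 3 * δ * x ^ 2)
      = fun x => 2 * γ + 6 * δ * x := funext fun x => by
    have h := ((((hasDerivAt_id x).const_mul (2 * γ)).const_add β)).add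
      ((hasDerivAt_pow 2 x).const_mul (3 * δ))
    refine h.deriv.trans ?_
    norm_num
    ring
  refine ⟨by fun_prop, by simp [hy], hz, by rw [hd]; simp [hp], by simpa [hd] using hq, hb, ?_⟩
  rw [hd, hd']
  exact hb'

/-- With `s = x / L`, the Hermite cubics `1 - 3s² + 2s³` and `x (1 - s)²` work. They are bounded by
`1` and `L`, their second derivatives by `6 / L²` and `4 / L`, so one `K` serves the whole range of
lengths. -/
theorem exists_isProfile {ℓ Λ : ℝ} (hℓ : 0 < ℓ) (hΛ : ℓ ≤ Λ) : ∃ K, 0 ≤ K ∧ ∀ L ∈ Icc ℓ Λ,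
    (∃ η, IsProfile L K η 1 0 0 0) ∧ ∃ η, IsProfile L K η 0 0 1 0 := by
  have hΛ0 : 0 < Λ := hℓ.trans_le hΛ
  refine ⟨1 + Λ + 6 / ℓ ^ 2 + 4 / ℓ, by positivity, fun L hL => ?_⟩
  have hL0 : 0 < L := hℓ.trans_le hL.1
  have e₁ : 6 / L ^ 2 ≤ 6 / ℓ ^ 2 := by
    have := hL.1
    gcongr
  have e₂ : 4 / L ≤ 4 / ℓ := by
    have := hL.1
    gcongr
  have p₁ : 0 < 6 / ℓ ^ 2 := by positivity
  have p₂ : 0 < 4 / ℓ := by positivity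
  have ht : ∀ x ∈ Icc 0 L, 0 ≤ x / L ∧ x / L ≤ 1 := fun x hx =>
    ⟨div_nonneg hx.1 hL0.le, (div_le_one hL0).2 hx.2⟩
  refine ⟨⟨_, isProfile_cubic (α := 1) (β := 0) (γ := -3 / L ^ 2) (δ := 2 / L ^ 3) rfl ?_ rfl ?_
    (fun x hx => ?_) (fun x hx => ?_)⟩, ⟨_, isProfile_cubic (α := 0) (β := 1) (γ := -2 / L)
    (δ := 1 / L ^ 2) rfl ?_ rfl ?_ (fun x hx => ?_) (fun x hx => ?_)⟩⟩
  · field_simp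
    ring
  · field_simp
    ring
  · obtain ⟨h₀, h₁⟩ := ht x hx
    have : 1 + 0 * x + -3 / L ^ 2 * x ^ 2 + 2 / L ^ 3 * x ^ 3
        = 1 - 3 * (x / L) ^ 2 + 2 * (x / L) ^ 3 := by
      field_simp
      ring
    rw [this, abs_le]
    constructor <;> nlinarith [mul_nonneg (mul_nonneg h₀ h₀) (sub_nonneg.2 h₁),
      mul_nonneg (mul_nonneg (sub_nonneg.2 h₁) (sub_nonneg.2 h₁)) h₀, hL.1, hL.2]
  · obtain ⟨h₀, h₁⟩ := ht x hx
    have : 2 * (-3 / L ^ 2) + 6 * (2 / L ^ 3) * x = 6 / L ^ 2 * (2 * (x / L) - 1) := by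
      field_simp
      ring
    have p₃ : 0 < 6 / L ^ 2 := by positivity
    rw [this, abs_mul, abs_of_pos p₃]
    have : |2 * (x / L) - 1| ≤ 1 := abs_le.2 ⟨by linarith, by linarith⟩
    nlinarith [mul_le_mul_of_nonneg_left this p₃.le, hL.1, hL.2]
  · field_simp
    ring
  · field_simp
    ring
  · obtain ⟨h₀, h₁⟩ := ht x hx
    have : 0 + 1 * x + -2 / L * x ^ 2 + 1 / L ^ 2 * x ^ 3 = x * (1 - x / L) ^ 2 := by
      field_simp
      ring
    rw [this, abs_mul, abs_of_nonneg hx.1, abs_of_nonneg (sq_nonneg _)]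
    have : (1 - x / L) ^ 2 ≤ 1 := by nlinarith
    nlinarith [mul_le_mul_of_nonneg_left this hx.1, hL.1, hL.2, hx.2]
  · obtain ⟨h₀, h₁⟩ := ht x hx
    have : 2 * (-2 / L) + 6 * (1 / L ^ 2) * x = 4 / L * (3 / 2 * (x / L) - 1) := by
      field_simp
      ring
    have p₃ : 0 < 4 / L := by positivity
    rw [this, abs_mul, abs_of_pos p₃]
    have : |3 / 2 * (x / L) - 1| ≤ 1 := abs_le.2 ⟨by linarith, by linarith⟩
    nlinarith [mul_le_mul_of_nonneg_left this p₃.le, hL.1, hL.2]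

end Smooth

/-! ### Prescribing and estimating boundary values, uniformly in the edge. -/

section Traces

variable {L : ℝ} {M : Matrix (Fin 2) (Fin 2) ℂ}

theorem IsProfile.edgeTraces (hL : 0 < L) {K : ℝ} {η : ℝ → ℝ} {y z p q : ℝ}
    (h : IsProfile L K η y z p q) (M : Matrix (Fin 2) (Fin 2) ℂ) (a : ℝ) (c : Spinor) :
    EdgeTraces M (profileEdge L M a c η h.contDiff) (y • frame M a c 0) (z • frame M a c L)
      (p • frame M a c 0) (q • frame M a c L) := by
  obtain ⟨hη, rfl, rfl, rfl, rfl, -, -⟩ := h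
  have e := covDeriv_profileEdge (M := M) hL a c hη
  have h := contDiff_smul_frame hη M a c
  have h' := contDiff_smul_frame (contDiff_infty_iff_deriv.1 hη).2 M a c
  exact ⟨smoothEdge_mem hL h, hasValueAt_smoothEdge h 0, hasValueAt_smoothEdge h L,
    e ▸ hasValueAt_smoothEdge h' 0, e ▸ hasValueAt_smoothEdge h' L⟩

theorem IsProfile.norm_le (hL : 0 < L) (hM : M.IsHermitian) {K : ℝ} (hK : 0 ≤ K) {η : ℝ → ℝ}
    {y z p q : ℝ} (h : IsProfile L K η y z p q) (a : ℝ) (c : Spinor) :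
    ‖profileEdge L M a c η h.contDiff‖ ≤ √L * (K * ‖c‖) ∧
      ‖covDeriv M (covDeriv M (profileEdge L M a c η h.contDiff))‖ ≤ √L * (K * ‖c‖) := by
  rw [covDeriv_profileEdge hL, covDeriv_profileEdge hL]
  exact ⟨norm_profileEdge_le hM hL.le a c _ hK h.bound,
    norm_profileEdge_le hM hL.le a c _ hK h.bound_deriv⟩

/-- Edge functions with one prescribed boundary value, with bounds that are uniform in the edge. -/
theorem exists_edgeTraces_single {ℓ Λ : ℝ} (hℓ : 0 < ℓ) (hΛ : ℓ ≤ Λ) :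
    ∃ C, 0 ≤ C ∧ ∀ L ∈ Icc ℓ Λ, ∀ M : Matrix (Fin 2) (Fin 2) ℂ, M.IsHermitian → ∀ c : Spinor,
      (∃ g : EdgeL2 L, EdgeTraces M g c 0 0 0 ∧ ‖g‖ ≤ C * ‖c‖ ∧
        ‖covDeriv M (covDeriv M g)‖ ≤ C * ‖c‖) ∧
      (∃ g : EdgeL2 L, EdgeTraces M g 0 c 0 0 ∧ ‖g‖ ≤ C * ‖c‖ ∧
        ‖covDeriv M (covDeriv M g)‖ ≤ C * ‖c‖) ∧
      (∃ g : EdgeL2 L, EdgeTraces M g 0 0 c 0 ∧ ‖g‖ ≤ C * ‖c‖ ∧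
        ‖covDeriv M (covDeriv M g)‖ ≤ C * ‖c‖) ∧
      ∃ g : EdgeL2 L, EdgeTraces M g 0 0 0 c ∧ ‖g‖ ≤ C * ‖c‖ ∧
        ‖covDeriv M (covDeriv M g)‖ ≤ C * ‖c‖ := by
  obtain ⟨K, hK, h⟩ := exists_isProfile hℓ hΛ
  refine ⟨√Λ * K, by positivity, fun L hL M hM c => ?_⟩
  have hL0 : 0 < L := hℓ.trans_le hL.1
  have key : ∀ {η : ℝ → ℝ} {y z p q : ℝ} (hη : IsProfile L K η y z p q) (a : ℝ) (c' : Spinor),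
      ‖c'‖ = ‖c‖ → ‖profileEdge L M a c' η hη.contDiff‖ ≤ √Λ * K * ‖c‖ ∧
      ‖covDeriv M (covDeriv M (profileEdge L M a c' η hη.contDiff))‖ ≤ √Λ * K * ‖c‖ := by
    intro η y z p q hη a c' hc
    have := hη.norm_le hL0 hM hK a c'
    have hs : √L * (K * ‖c'‖) ≤ √Λ * K * ‖c‖ := by
      rw [hc, ← mul_assoc]
      have := Real.sqrt_le_sqrt hL.2
      gcongr
    exact ⟨this.1.trans hs, this.2.trans hs⟩
  obtain ⟨⟨η, hη⟩, θ, hθ⟩ := h L hL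
  -- Frames are anchored at the end carrying the nonzero trace. The reflected slope is `-1`, whence
  -- `-c` in the last case.
  refine ⟨⟨_, ?_, key hη 0 c rfl⟩, ⟨_, ?_, key hη.reflect L c rfl⟩, ⟨_, ?_, key hθ 0 c rfl⟩,
    ⟨_, ?_, key hθ.reflect L (-c) (norm_neg c)⟩⟩
  · simpa using hη.edgeTraces hL0 M 0 c
  · simpa using hη.reflect.edgeTraces hL0 M L c
  · simpa using hθ.edgeTraces hL0 M 0 c
  · simpa using hθ.reflect.edgeTraces hL0 M L (-c)

/-- Superposition of four functions with a single nonzero trace; no uniformity is needed, so the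
length range is just `{L}`. -/
theorem EdgeTraces.exists (hL : 0 < L) (hM : M.IsHermitian) (y z p q : Spinor) :
    ∃ g : EdgeL2 L, EdgeTraces M g y z p q := by
  obtain ⟨C, -, h⟩ := exists_edgeTraces_single hL le_rfl
  have hm : L ∈ Icc L L := ⟨le_rfl, le_rfl⟩
  obtain ⟨g₁, h₁, -⟩ := (h L hm M hM y).1
  obtain ⟨g₂, h₂, -⟩ := (h L hm M hM z).2.1
  obtain ⟨g₃, h₃, -⟩ := (h L hm M hM p).2.2.1
  obtain ⟨g₄, h₄, -⟩ := (h L hm M hM q).2.2.2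
  exact ⟨g₁ + g₂ + g₃ + g₄, by simpa using ((h₁.add h₂).add h₃).add h₄⟩

/-- The boundary values are controlled by `‖f‖` and `‖D² f‖`, uniformly in the edge. -/
theorem EdgeTraces.exists_bound {ℓ Λ : ℝ} (hℓ : 0 < ℓ) (hΛ : ℓ ≤ Λ) :
    ∃ C, 0 ≤ C ∧ ∀ L ∈ Icc ℓ Λ, ∀ M : Matrix (Fin 2) (Fin 2) ℂ, M.IsHermitian →
      ∀ (f : EdgeL2 L) (y z p q : Spinor), EdgeTraces M f y z p q →
        ‖y‖ ≤ C * (‖f‖ + ‖covDeriv M (covDeriv M f)‖) ∧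
        ‖z‖ ≤ C * (‖f‖ + ‖covDeriv M (covDeriv M f)‖) ∧
        ‖p‖ ≤ C * (‖f‖ + ‖covDeriv M (covDeriv M f)‖) ∧
        ‖q‖ ≤ C * (‖f‖ + ‖covDeriv M (covDeriv M f)‖) := by
  obtain ⟨C, hC, h⟩ := exists_edgeTraces_single hℓ hΛ
  refine ⟨C, hC, fun L hL M hM f y z p q hf => ?_⟩
  have hL0 : 0 < L := hℓ.trans_le hL.1
  -- Duality: if the boundary form of `f` and `g` has modulus `‖c‖²` while `g` has size `C ‖c‖`,
  -- Cauchy–Schwarz and division by `‖c‖` bound `c`.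
  have key : ∀ (c : Spinor) (g : EdgeL2 L), ‖g‖ ≤ C * ‖c‖ →
      ‖covDeriv M (covDeriv M g)‖ ≤ C * ‖c‖ →
      ‖⟪covDeriv M (covDeriv M f), g⟫_ℂ - ⟪f, covDeriv M (covDeriv M g)⟫_ℂ‖ = ‖c‖ * ‖c‖ →
      ‖c‖ ≤ C * (‖f‖ + ‖covDeriv M (covDeriv M f)‖) := by
    intro c g h₁ h₂ h₃
    have h₄ : ‖c‖ * ‖c‖ ≤ (C * (‖f‖ + ‖covDeriv M (covDeriv M f)‖)) * ‖c‖ := by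
      rw [← h₃]
      refine (norm_sub_le _ _).trans ((add_le_add (norm_inner_le_norm _ _)
        (norm_inner_le_norm _ _)).trans ?_)
      refine (add_le_add (mul_le_mul_of_nonneg_left h₁ (norm_nonneg _))
        (mul_le_mul_of_nonneg_left h₂ (norm_nonneg _))).trans_eq ?_
      ring
    rcases (norm_nonneg c).eq_or_lt with h0 | h0
    · rw [← h0]
      positivity
    · exact le_of_mul_le_mul_right h₄ h0
  refine ⟨?_, ?_, ?_, ?_⟩
  -- The boundary form pairs values with covariant derivatives at the same end, so each trace is
  -- isolated by a `g` carrying only the conjugate one.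
  · obtain ⟨g, hg, h₁, h₂⟩ := (h L hL M hM y).2.2.1
    exact key y g h₁ h₂ (by rw [hf.green hL0 hM hg]; simp [pow_two])
  · obtain ⟨g, hg, h₁, h₂⟩ := (h L hL M hM z).2.2.2
    exact key z g h₁ h₂ (by rw [hf.green hL0 hM hg]; simp [pow_two])
  · obtain ⟨g, hg, h₁, h₂⟩ := (h L hL M hM p).1
    exact key p g h₁ h₂ (by rw [hf.green hL0 hM hg]; simp [pow_two])
  · obtain ⟨g, hg, h₁, h₂⟩ := (h L hL M hM q).2.1
    exact key q g h₁ h₂ (by rw [hf.green hL0 hM hg]; simp [pow_two])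

end Traces

/-! ### Interior regularity from test functions on one edge. -/

section Interior

variable {L : ℝ} {M : Matrix (Fin 2) (Fin 2) ℂ} {φ : ℝ → ℝ}

/-- A test function times a constant spinor. -/
noncomputable def testEdge (hφ : IsTest L φ) (c : Spinor) : EdgeL2 L :=
  smoothEdge L (fun x => φ x • c) (hφ.contDiff.smul contDiff_const)

theorem coeFn_testEdge (hφ : IsTest L φ) (c : Spinor) :
    testEdge hφ c =ᵐ[edgeMeasure L] fun x => φ x • c :=
  coeFn_smoothEdge _

theorem isWeakDeriv_testEdge (hL : 0 < L) (hφ : IsTest L φ) (c : Spinor) :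
    IsWeakDeriv (testEdge hφ c) (testEdge hφ.deriv c) := by
  have hd : deriv (fun x => φ x • c) = fun x => deriv φ x • c := funext fun x =>
    ((hφ.contDiff.differentiable (by simp) x).hasDerivAt.smul_const c).deriv
  have h := isWeakDeriv_smoothEdge hL (u := fun x => φ x • c) (hφ.contDiff.smul contDiff_const)
  simp only [hd] at h
  exact h

theorem matAct_testEdge (M : Matrix (Fin 2) (Fin 2) ℂ) (hφ : IsTest L φ) (c : Spinor) :
    matAct M (testEdge hφ c)
      = testEdge hφ (Matrix.toEuclideanCLM (n := Fin 2) (𝕜 := ℂ) M c) := by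
  apply Lp.ext
  filter_upwards [coeFn_matAct M (testEdge hφ c), coeFn_testEdge hφ c,
    coeFn_testEdge hφ (Matrix.toEuclideanCLM (n := Fin 2) (𝕜 := ℂ) M c)] with x h₁ h₂ h₃
  rw [h₁, h₂, h₃, ContinuousLinearMap.map_smul_of_tower]

theorem covDeriv_testEdge (hL : 0 < L) (M : Matrix (Fin 2) (Fin 2) ℂ) (hφ : IsTest L φ)
    (c : Spinor) :
    covDeriv M (testEdge hφ c) = testEdge hφ.deriv c - Complex.I • matAct M (testEdge hφ c) := by
  rw [covDeriv, (isWeakDeriv_testEdge hL hφ c).weakDeriv_eq]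

theorem IsWeakDeriv.matAct {f g : EdgeL2 L} (h : IsWeakDeriv f g)
    (M : Matrix (Fin 2) (Fin 2) ℂ) : IsWeakDeriv (matAct M f) (matAct M g) :=
  h.map _

theorem covDeriv_covDeriv {f g h : EdgeL2 L} (hf : IsWeakDeriv f g) (hg : IsWeakDeriv g h) :
    covDeriv M (covDeriv M f)
      = h - (2 * Complex.I) • matAct M g - matAct M (matAct M f) := by
  rw [covDeriv, covDeriv, hf.weakDeriv_eq, (hg.sub ((hf.matAct M).smul Complex.I)).weakDeriv_eq,
    map_sub, map_smul, smul_sub, smul_smul, Complex.I_mul_I, mul_smul, two_smul, neg_one_smul]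
  abel

theorem edgeTraces_testEdge (hL : 0 < L) (M : Matrix (Fin 2) (Fin 2) ℂ) (hφ : IsTest L φ)
    (c : Spinor) : EdgeTraces M (testEdge hφ c) 0 0 0 0 := by
  have hv : ∀ (ψ : ℝ → ℝ) (hψ : IsTest L ψ) (c : Spinor) (x : ℝ), x ∉ Ioo 0 L →
      HasValueAt (testEdge hψ c) x 0 := fun ψ hψ c x hx =>
    ⟨fun x => ψ x • c, (hψ.continuous.smul continuous_const).continuousOn, coeFn_testEdge hψ c, by
      simp only [hψ.eq_zero hx, zero_smul]⟩
  have h0 : (0 : ℝ) ∉ Ioo 0 L := by simp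
  have h1 : L ∉ Ioo 0 L := by simp
  have hc : ∀ x, x ∉ Ioo 0 L → HasValueAt (covDeriv M (testEdge hφ c)) x 0 := fun x hx => by
    rw [covDeriv_testEdge hL, matAct_testEdge, sub_eq_add_neg, ← neg_smul]
    simpa using (hv _ hφ.deriv c x hx).add ((hv _ hφ _ x hx).smul (-Complex.I))
  exact ⟨smoothEdge_mem hL _, hv _ hφ c 0 h0, hv _ hφ c L h1, hc 0 h0, hc L h1⟩

theorem inner_testEdge (f : EdgeL2 L) (hφ : IsTest L φ) (c : Spinor) :
    ⟪f, testEdge hφ c⟫_ℂ = ⟪∫ x, φ x • f x ∂(edgeMeasure L), c⟫_ℂ := by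
  rw [← inner_conj_symm, ← inner_conj_symm (∫ x, φ x • f x ∂(edgeMeasure L)), L2.inner_def,
    ← integral_inner (hφ.integrable_smul f)]
  congr 1
  apply integral_congr_ae
  filter_upwards [coeFn_testEdge hφ c] with x hx
  rw [hx, ← Complex.coe_smul, ← Complex.coe_smul, inner_smul_left, inner_smul_right,
    Complex.conj_ofReal]

theorem eq_of_inner_testEdge {f g : EdgeL2 L}
    (h : ∀ φ (hφ : IsTest L φ) (c : Spinor), ⟪f, testEdge hφ c⟫_ℂ = ⟪g, testEdge hφ c⟫_ℂ) :
    f = g := by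
  refine Lp.ext (ae_eq_of_integral_test f.integrable g.integrable fun φ hφ => ?_)
  refine ext_inner_right ℂ fun c => ?_
  rw [← inner_testEdge f hφ, ← inner_testEdge g hφ, h]

/-- A weak solution of `R f = w` on an edge is a strong one. -/
theorem edgeRashba_eq_of_weak (hL : 0 < L) {d : EuclideanSpace ℝ (Fin 2)} {a kR : ℝ}
    {f w : EdgeL2 L} (h : ∀ φ (hφ : IsTest L φ) (c : Spinor),
      ⟪w, testEdge hφ c⟫_ℂ = ⟪f, edgeRashba d a kR (testEdge hφ c)⟫_ℂ) :
    f ∈ SobolevTwo L ∧ edgeRashba d a kR f = w := by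
  set M := edgePotential d a kR with hMd
  have hM : M.IsHermitian := isHermitian_edgePotential d a kR
  -- Expanding `D²` turns the weak equation into `f'' = b - a'` with `a = -2iMf` and `b = M²f - k_R²
  -- f - w`.
  obtain ⟨g, hfg, hg⟩ := exists_isWeakDeriv_of_second hL (f := f)
    (a := -((2 * Complex.I) • matAct M f))
    (b := matAct M (matAct M f) - ((kR : ℂ) ^ 2) • f - w) fun φ hφ => by
      refine ext_inner_right ℂ fun c => ?_
      have e := h φ hφ c
      rw [edgeRashba_eq d a kR (edgeTraces_testEdge hL M hφ c).mem, ← hMd,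
        covDeriv_covDeriv (isWeakDeriv_testEdge hL hφ c) (isWeakDeriv_testEdge hL hφ.deriv c)] at e
      rw [inner_add_left, ← inner_testEdge _ hφ.deriv.deriv, ← inner_testEdge _ hφ.deriv,
        ← inner_testEdge _ hφ]
      simp only [inner_sub_left, inner_sub_right, inner_neg_left, inner_neg_right, inner_smul_left,
        inner_smul_right, inner_matAct hM, map_mul, map_pow, Complex.conj_I, Complex.conj_ofReal,
        map_ofNat] at e ⊢
      linear_combination e
  -- The first derivative of `f` is `g - a`, and `a` is a constant matrix applied to `f`, now known
  -- to be in `W^{1,2}`; this gives the second derivative.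
  have hfg' : IsWeakDeriv (g - -((2 * Complex.I) • matAct M f)) _ :=
    hg.sub ((hfg.matAct M).smul (2 * Complex.I)).neg
  have hf2 : f ∈ SobolevTwo L := ⟨_, _, hfg, hfg'⟩
  refine ⟨hf2, ?_⟩
  rw [edgeRashba_eq d a kR hf2, ← hMd, covDeriv_covDeriv hfg hfg']
  abel

end Interior

/-! ### Edge ends, traces and Green's formula on the graph. -/

namespace MetricGraph

variable {V E : Type*} (G : MetricGraph V E)

theorem length_pos (e : E) : 0 < G.length e :=
  G.minLength_pos.trans_le (G.length_mem e).1

/-- The vertex of an edge end: `inl e` is the initial, `inr e` the terminal end of `e`. -/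
def endVertex : E ⊕ E → V :=
  Sum.elim G.src G.tgt

/-- The edge ends at a vertex. -/
noncomputable def ends (v : V) : Finset (E ⊕ E) :=
  (G.finite_out v).toFinset.disjSum (G.finite_in v).toFinset

variable {G}

theorem mem_ends {v : V} {a : E ⊕ E} : a ∈ G.ends v ↔ G.endVertex a = v := by
  rcases a with e | e <;> simp [ends, endVertex]

/-- The finite sets of ends are the fibres of `endVertex`, and an unconditionally convergent sum can
be taken fibrewise. -/
theorem hasSum_ends {b : E ⊕ E → ℂ} {s : ℂ} (hb : HasSum b s) :
    HasSum (fun v => ∑ a ∈ G.ends v, b a) s := by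
  have h : (fun v => ∑ a ∈ G.ends v, b a) = fun v => ∑' a : G.endVertex ⁻¹' {v}, b a := by
    funext v
    have hs : {a | a ∈ G.ends v} = G.endVertex ⁻¹' {v} := Set.ext fun a => mem_ends
    rw [← Finset.tsum_subtype]
    exact tsum_congr_set_coe b hs
  rw [h]
  exact hb.tsum_fiberwise G.endVertex

variable (d : E → EuclideanSpace ℝ (Fin 2)) (A : E → ℝ) (kR : ℝ)

/-- Values `t` of `f` and outgoing covariant derivatives `n` of `f` at the edge ends. -/
def HasTraces (f : ∀ e, EdgeL2 (G.length e)) (t n : E ⊕ E → Spinor) : Prop :=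
  ∀ e, EdgeTraces (edgePotential (d e) (A e) kR) (f e) (t (.inl e)) (t (.inr e))
    (n (.inl e)) (-n (.inr e))

theorem exists_hasTraces {f : ∀ e, EdgeL2 (G.length e)} (hf : ∀ e, f e ∈ SobolevTwo (G.length e)) :
    ∃ t n, HasTraces d A kR f t n := by
  choose y z p q h using fun e =>
    EdgeTraces.exists_of_mem (G.length_pos e) (edgePotential (d e) (A e) kR) (hf e)
  exact ⟨Sum.elim y z, Sum.elim p (-q), fun e => by simpa using h e⟩

variable {d A kR}

theorem HasTraces.vertexConditions {ε : V → ℝ} {f : ∀ e, EdgeL2 (G.length e)}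
    {F : V → Spinor} {n : E ⊕ E → Spinor} (h : HasTraces d A kR f (fun a => F (G.endVertex a)) n)
    (hv : ∀ v, ∑ a ∈ G.ends v, n a = (ε v : ℂ) • F v) : G.VertexConditions d A kR ε f := by
  refine ⟨F, fun e => n (.inl e), fun e => -n (.inr e), fun e => (h e).left, fun e => (h e).right,
    fun e => (h e).covLeft, fun e => (h e).covRight, fun v => ?_⟩
  rw [← hv v, ends, Finset.sum_disjSum, Finset.sum_neg_distrib, sub_neg_eq_add]

theorem VertexConditions.exists_hasTraces {ε : V → ℝ} {f : ∀ e, EdgeL2 (G.length e)}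
    (hf : ∀ e, f e ∈ SobolevTwo (G.length e)) (h : G.VertexConditions d A kR ε f) :
    ∃ (F : V → Spinor) (n : E ⊕ E → Spinor), HasTraces d A kR f (fun a => F (G.endVertex a)) n ∧
      ∀ v, ∑ a ∈ G.ends v, n a = (ε v : ℂ) • F v := by
  obtain ⟨F, p, q, h₁, h₂, h₃, h₄, h₅⟩ := h
  refine ⟨F, Sum.elim p (-q), fun e => ⟨hf e, h₁ e, h₂ e, h₃ e, by simpa using h₄ e⟩, fun v => ?_⟩
  rw [← h₅ v, ends, Finset.sum_disjSum]
  simp [sub_eq_add_neg]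

theorem summable_norm_sq (f : GraphL2 G) : Summable fun e => ‖f e‖ ^ 2 := by
  have := (lp.memℓp f).summable (by norm_num)
  simpa using this

/-- The boundary values of functions in the maximal domain are square summable. -/
theorem HasTraces.summable {f w : GraphL2 G} {t n : E ⊕ E → Spinor}
    (h : HasTraces d A kR (fun e => f e) t n)
    (hw : ∀ e, edgeRashba (d e) (A e) kR (f e) = w e) :
    (Summable fun a => ‖t a‖ ^ 2) ∧ Summable fun a => ‖n a‖ ^ 2 := by
  obtain ⟨C, hC, hb⟩ := EdgeTraces.exists_bound G.minLength_pos G.minLength_lt_maxLength.le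
  -- The factor `1 + kR²` absorbs the zeroth-order term, since `D² f = -(w + kR² f)`.
  set B : E → ℝ := fun e => C * ((1 + kR ^ 2) * (‖f e‖ + ‖w e‖)) with hB
  have hBs : Summable fun e => B e ^ 2 := by
    have hs := ((summable_norm_sq f).add (summable_norm_sq w)).mul_left
      (2 * (C * (1 + kR ^ 2)) ^ 2)
    refine Summable.of_nonneg_of_le (fun e => sq_nonneg _) (fun e => ?_) hs
    have h₁ : B e ^ 2 = (C * (1 + kR ^ 2)) ^ 2 * (‖f e‖ + ‖w e‖) ^ 2 := by
      rw [hB]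
      ring
    have h₂ : (‖f e‖ + ‖w e‖) ^ 2 ≤ 2 * (‖f e‖ ^ 2 + ‖w e‖ ^ 2) := add_sq_le
    rw [h₁]
    calc (C * (1 + kR ^ 2)) ^ 2 * (‖f e‖ + ‖w e‖) ^ 2
        ≤ (C * (1 + kR ^ 2)) ^ 2 * (2 * (‖f e‖ ^ 2 + ‖w e‖ ^ 2)) := by gcongr
      _ = _ := by ring
  have key : ∀ e, ‖t (.inl e)‖ ≤ B e ∧ ‖t (.inr e)‖ ≤ B e ∧ ‖n (.inl e)‖ ≤ B e ∧
      ‖n (.inr e)‖ ≤ B e := by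
    intro e
    have hM := isHermitian_edgePotential (d e) (A e) kR
    have hbe := hb _ (G.length_mem e) _ hM _ _ _ _ _ (h e)
    have hle : C * (‖f e‖ + ‖covDeriv (edgePotential (d e) (A e) kR)
        (covDeriv (edgePotential (d e) (A e) kR) (f e))‖) ≤ B e := by
      have hR := edgeRashba_eq (d e) (A e) kR (h e).mem
      rw [hw e] at hR
      have hD : covDeriv (edgePotential (d e) (A e) kR)
          (covDeriv (edgePotential (d e) (A e) kR) (f e)) = -(w e + ((kR : ℂ) ^ 2) • f e) := by
        rw [hR]
        abel
      have hn : ‖((kR : ℂ) ^ 2) • f e‖ = kR ^ 2 * ‖f e‖ := by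
        rw [norm_smul, norm_pow, Complex.norm_real, Real.norm_eq_abs, sq_abs]
      have hs := norm_add_le (w e) (((kR : ℂ) ^ 2) • f e)
      rw [hn] at hs
      rw [hD, norm_neg]
      refine mul_le_mul_of_nonneg_left ?_ hC
      have := mul_nonneg (sq_nonneg kR) (norm_nonneg (w e))
      linarith
    rw [norm_neg] at hbe
    exact ⟨hbe.1.trans hle, hbe.2.1.trans hle, hbe.2.2.1.trans hle, hbe.2.2.2.trans hle⟩
  have hsum : ∀ u : E ⊕ E → Spinor, (∀ e, ‖u (.inl e)‖ ≤ B e) → (∀ e, ‖u (.inr e)‖ ≤ B e) →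
      Summable fun a => ‖u a‖ ^ 2 := fun u h₁ h₂ => Summable.sum _
    (Summable.of_nonneg_of_le (fun e => sq_nonneg _)
      (fun e => pow_le_pow_left₀ (norm_nonneg _) (h₁ e) 2) hBs)
    (Summable.of_nonneg_of_le (fun e => sq_nonneg _)
      (fun e => pow_le_pow_left₀ (norm_nonneg _) (h₂ e) 2) hBs)
  exact ⟨hsum t (fun e => (key e).1) fun e => (key e).2.1,
    hsum n (fun e => (key e).2.2.1) fun e => (key e).2.2.2⟩

theorem summable_inner_of_norm_sq {ι : Type*} {u v : ι → Spinor}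
    (hu : Summable fun a => ‖u a‖ ^ 2) (hv : Summable fun a => ‖v a‖ ^ 2) :
    Summable fun a => ⟪u a, v a⟫_ℂ := by
  refine Summable.of_norm_bounded (hu.add hv) fun a => (norm_inner_le_norm _ _).trans ?_
  nlinarith [sq_nonneg (‖u a‖ - ‖v a‖), sq_nonneg ‖u a‖, sq_nonneg ‖v a‖]

/-- Green's formula on the graph, grouped by vertices. -/
theorem HasTraces.hasSum_green {f w f' w' : GraphL2 G} {t n t' n' : E ⊕ E → Spinor}
    (h : HasTraces d A kR (fun e => f e) t n)
    (hw : ∀ e, edgeRashba (d e) (A e) kR (f e) = w e)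
    (h' : HasTraces d A kR (fun e => f' e) t' n')
    (hw' : ∀ e, edgeRashba (d e) (A e) kR (f' e) = w' e) :
    HasSum (fun v => ∑ a ∈ G.ends v, (⟪n a, t' a⟫_ℂ - ⟪t a, n' a⟫_ℂ))
      (⟪w, f'⟫_ℂ - ⟪f, w'⟫_ℂ) := by
  obtain ⟨ht, hn⟩ := h.summable hw
  obtain ⟨ht', hn'⟩ := h'.summable hw'
  -- Regrouping by vertices requires summability over individual ends, not only over edges;
  -- square-summable traces provide it.
  have hb : Summable fun a => ⟪n a, t' a⟫_ℂ - ⟪t a, n' a⟫_ℂ :=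
    (summable_inner_of_norm_sq hn ht').sub (summable_inner_of_norm_sq ht hn')
  have hl := (hb.comp_injective Sum.inl_injective).hasSum
  have hr := (hb.comp_injective Sum.inr_injective).hasSum
  have hG := (lp.hasSum_inner (𝕜 := ℂ) w f').sub (lp.hasSum_inner (𝕜 := ℂ) f w')
  have e : (fun e => ⟪w e, f' e⟫_ℂ - ⟪f e, w' e⟫_ℂ) = fun e =>
      ((fun a => ⟪n a, t' a⟫_ℂ - ⟪t a, n' a⟫_ℂ) ∘ Sum.inl) e +
        ((fun a => ⟪n a, t' a⟫_ℂ - ⟪t a, n' a⟫_ℂ) ∘ Sum.inr) e := by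
    funext e
    rw [← hw, ← hw', (h e).green_rashba (G.length_pos e) (h' e)]
    simp only [inner_neg_left, inner_neg_right, Function.comp_apply]
    ring
  rw [e] at hG
  rw [hG.unique (hl.add hr)]
  exact hasSum_ends (hl.sum hr)

/-! ### Symmetry, density and self-adjointness. -/

variable {ε : V → ℝ}

/-- The Rashba Hamiltonian is symmetric. -/
theorem rashbaHamiltonian_isFormalAdjoint :
    (G.rashbaHamiltonian d A kR ε).IsFormalAdjoint (G.rashbaHamiltonian d A kR ε) := by
  intro x y
  obtain ⟨F, n, h, hv⟩ := VertexConditions.exists_hasTraces x.2.1 x.2.2.2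
  obtain ⟨F', n', h', hv'⟩ := VertexConditions.exists_hasTraces y.2.1 y.2.2.2
  have hG := h.hasSum_green (w := G.rashbaHamiltonian d A kR ε x) (fun e => rfl) h'
    (w' := G.rashbaHamiltonian d A kR ε y) (fun e => rfl)
  have h0 : ∀ v, ∑ a ∈ G.ends v, (⟪n a, F' (G.endVertex a)⟫_ℂ - ⟪F (G.endVertex a), n' a⟫_ℂ)
      = 0 := by
    intro v
    -- Continuity lets the common vertex values leave the sums, so the derivative conditions apply;
    -- the two terms cancel because `ε v` is real.
    have e : ∀ a ∈ G.ends v, ⟪n a, F' (G.endVertex a)⟫_ℂ - ⟪F (G.endVertex a), n' a⟫_ℂ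
        = ⟪n a, F' v⟫_ℂ - ⟪F v, n' a⟫_ℂ := fun a ha => by rw [mem_ends.1 ha]
    rw [Finset.sum_congr rfl e, Finset.sum_sub_distrib, ← sum_inner, ← inner_sum, hv, hv',
      inner_smul_left, inner_smul_right, Complex.conj_ofReal, sub_self]
  simp only [h0] at hG
  exact sub_eq_zero.1 (hG.unique hasSum_zero)

theorem edgeRashba_zero {L : ℝ} (D : EuclideanSpace ℝ (Fin 2)) (a k : ℝ) :
    edgeRashba D a k (0 : EdgeL2 L) = 0 := by
  simpa using edgeRashba_smul D a k 0 (SobolevTwo L).zero_mem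

theorem memℓp_of_finite {g : ∀ e, EdgeL2 (G.length e)} {s : Set E} (hs : s.Finite)
    (hg : ∀ e, e ∉ s → g e = 0) : Memℓp g 2 := by
  refine memℓp_gen (summable_of_hasFiniteSupport (hs.subset fun e he => ?_))
  by_contra h
  exact he (by simp [hg e h])

/-- Finitely many edge functions that satisfy the matching conditions are in the domain. -/
theorem exists_mem_domain {g : ∀ e, EdgeL2 (G.length e)} {s : Set E} (hs : s.Finite)
    (hg : ∀ e, e ∉ s → g e = 0) {F : V → Spinor} {n : E ⊕ E → Spinor}
    (h : HasTraces d A kR g (fun a => F (G.endVertex a)) n)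
    (hv : ∀ v, ∑ a ∈ G.ends v, n a = (ε v : ℂ) • F v) :
    ∃ x : (G.rashbaHamiltonian d A kR ε).domain, ∀ e, (x : GraphL2 G) e = g e :=
  ⟨⟨⟨g, memℓp_of_finite hs hg⟩, fun e => (h e).mem,
    memℓp_of_finite hs fun e he => by
      change edgeRashba _ _ _ (g e) = 0
      rw [hg e he, edgeRashba_zero],
    h.vertexConditions hv⟩, fun _ => rfl⟩

/-- All boundary data of an interior test function vanish, so its extension by zero satisfies every
matching condition and probes a single edge. -/
theorem exists_testEdge_mem_domain (e : E) {φ : ℝ → ℝ} (hφ : IsTest (G.length e) φ) (c : Spinor) :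
    ∃ x : (G.rashbaHamiltonian d A kR ε).domain, (∀ f : GraphL2 G,
      ⟪f, (x : GraphL2 G)⟫_ℂ = ⟪f e, testEdge hφ c⟫_ℂ) ∧ ∀ f : GraphL2 G,
      ⟪f, G.rashbaHamiltonian d A kR ε x⟫_ℂ
        = ⟪f e, edgeRashba (d e) (A e) kR (testEdge hφ c)⟫_ℂ := by
  classical
  have hne : ∀ e', e' ≠ e →
      (Pi.single e (testEdge hφ c) : ∀ e, EdgeL2 (G.length e)) e' = 0 := fun e' he' =>
    Pi.single_eq_of_ne he' _
  have ht : HasTraces (G := G) d A kR (Pi.single e (testEdge hφ c))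
      (fun a => (0 : V → Spinor) (G.endVertex a)) 0 := by
    intro e'
    by_cases he : e' = e
    · subst he
      rw [Pi.single_eq_same]
      simpa using edgeTraces_testEdge (G.length_pos e') (edgePotential (d e') (A e') kR) hφ c
    · rw [hne e' he]
      simpa using EdgeTraces.zero
  obtain ⟨x, hx⟩ := exists_mem_domain (ε := ε) (finite_singleton e) (fun e' he' => hne e' he') ht
    (by simp)
  refine ⟨x, fun f => ?_, fun f => ?_⟩
  · rw [lp.inner_eq_tsum, tsum_eq_single e fun e' he' => by rw [hx, hne e' he', inner_zero_right],
      hx, Pi.single_eq_same]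
  · have hR : ∀ e', (G.rashbaHamiltonian d A kR ε x) e'
        = edgeRashba (d e') (A e') kR ((x : GraphL2 G) e') := fun _ => rfl
    rw [lp.inner_eq_tsum, tsum_eq_single e fun e' he' => by
      rw [hR, hx, hne e' he', edgeRashba_zero, inner_zero_right], hR, hx, Pi.single_eq_same]

/-- The domain of the Rashba Hamiltonian is dense. -/
theorem dense_rashbaHamiltonian_domain :
    Dense ((G.rashbaHamiltonian d A kR ε).domain : Set (GraphL2 G)) := by
  rw [Submodule.dense_iff_topologicalClosure_eq_top, Submodule.topologicalClosure_eq_top_iff,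
    Submodule.eq_bot_iff]
  intro f hf
  refine lp.ext (funext fun e => eq_of_inner_testEdge fun φ hφ c => ?_)
  obtain ⟨x, hx, -⟩ := exists_testEdge_mem_domain (d := d) (A := A) (kR := kR) (ε := ε) e hφ c
  rw [← hx, (Submodule.mem_orthogonal' _ _).1 hf x x.2]
  exact (inner_zero_left _).symm

/-- Testing the vertex conditions at a single vertex. -/
theorem exists_vertex_test (v : V) (c : Spinor) {n : E ⊕ E → Spinor}
    (hn : ∀ a, a ∉ G.ends v → n a = 0)
    (hv : ∑ a ∈ G.ends v, n a = (ε v : ℂ) • c) :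
    ∃ (x : (G.rashbaHamiltonian d A kR ε).domain) (F : V → Spinor),
      HasTraces d A kR (fun e => (x : GraphL2 G) e) (fun a => F (G.endVertex a)) n ∧
      F v = c ∧ ∀ u, u ≠ v → F u = 0 := by
  classical
  set F : V → Spinor := Pi.single v c with hF
  have hFv : F v = c := Pi.single_eq_same _ _
  have hFu : ∀ u, u ≠ v → F u = 0 := fun u hu => Pi.single_eq_of_ne hu _
  -- Edges away from `v` get zero; incident ones get the prescribed data at both ends, which covers
  -- loops and gives zero data at neighbouring vertices. Local finiteness keeps the support finite.
  have hg : ∀ e, ∃ g : EdgeL2 (G.length e), EdgeTraces (edgePotential (d e) (A e) kR) g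
      (F (G.endVertex (.inl e))) (F (G.endVertex (.inr e))) (n (.inl e)) (-n (.inr e)) ∧
      (e ∉ {e | Sum.inl e ∈ G.ends v} ∪ {e | Sum.inr e ∈ G.ends v} → g = 0) := by
    intro e
    by_cases he : e ∈ {e | Sum.inl e ∈ G.ends v} ∪ {e | Sum.inr e ∈ G.ends v}
    · obtain ⟨g, hg⟩ := EdgeTraces.exists (G.length_pos e)
        (isHermitian_edgePotential (d e) (A e) kR) (F (G.endVertex (.inl e)))
        (F (G.endVertex (.inr e))) (n (.inl e)) (-n (.inr e))
      exact ⟨g, hg, fun h => absurd he h⟩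
    · have h₁ : Sum.inl e ∉ G.ends v := fun h => he (Or.inl h)
      have h₂ : Sum.inr e ∉ G.ends v := fun h => he (Or.inr h)
      refine ⟨0, ?_, fun _ => rfl⟩
      rw [hn _ h₁, hn _ h₂, hFu _ (fun h => h₁ (mem_ends.2 h)), hFu _ fun h => h₂ (mem_ends.2 h)]
      simpa using EdgeTraces.zero
  choose g hgt hg0 using hg
  have hfin : ({e | Sum.inl e ∈ G.ends v} ∪ {e | Sum.inr e ∈ G.ends v} : Set E).Finite :=
    ((G.ends v).finite_toSet.preimage Sum.inl_injective.injOn).union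
      ((G.ends v).finite_toSet.preimage Sum.inr_injective.injOn)
  obtain ⟨x, hx⟩ := exists_mem_domain (ε := ε) hfin hg0 (F := F) (n := n) hgt fun u => by
    by_cases hu : u = v
    · rw [hu, hv, hFv]
    · rw [hFu u hu, smul_zero]
      refine Finset.sum_eq_zero fun a ha => hn a fun h => hu ?_
      rw [← mem_ends.1 ha, mem_ends.1 h]
  refine ⟨x, F, ?_, hFv, hFu⟩
  rwa [show (fun e => (x : GraphL2 G) e) = g from funext hx]

/-- The adjoint of the Rashba Hamiltonian is a restriction of it. -/
theorem mem_rashbaDomain_of_adjoint {f w : GraphL2 G}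
    (h : ∀ x : (G.rashbaHamiltonian d A kR ε).domain,
      ⟪w, (x : GraphL2 G)⟫_ℂ = ⟪f, G.rashbaHamiltonian d A kR ε x⟫_ℂ) :
    ∃ hf : f ∈ (G.rashbaHamiltonian d A kR ε).domain, G.rashbaHamiltonian d A kR ε ⟨f, hf⟩ = w := by
  classical
  have hint : ∀ e, f e ∈ SobolevTwo (G.length e) ∧ edgeRashba (d e) (A e) kR (f e) = w e :=
    fun e => edgeRashba_eq_of_weak (G.length_pos e) fun φ hφ c => by
      obtain ⟨x, hx, hx'⟩ := exists_testEdge_mem_domain (d := d) (A := A) (kR := kR) (ε := ε) e hφ c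
      rw [← hx, ← hx', h]
  obtain ⟨t, n, ht⟩ := exists_hasTraces d A kR fun e => (hint e).1
  -- Green's formula against a domain element with value `c` and outgoing derivatives `m` at `v`,
  -- and zero data elsewhere: the total is zero by the adjoint relation, and only `v` contributes.
  have key : ∀ (v : V) (c : Spinor) (m : E ⊕ E → Spinor), (∀ a, a ∉ G.ends v → m a = 0) →
      ∑ a ∈ G.ends v, m a = (ε v : ℂ) • c →
      ∑ a ∈ G.ends v, ⟪n a, c⟫_ℂ = ∑ a ∈ G.ends v, ⟪t a, m a⟫_ℂ := by
    intro v c m hm hmv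
    obtain ⟨x, F, hx, hFv, hFu⟩ := exists_vertex_test (d := d) (A := A) (kR := kR) v c hm hmv
    have hG := ht.hasSum_green (fun e => (hint e).2) hx
      (w' := G.rashbaHamiltonian d A kR ε x) (fun e => rfl)
    rw [h x, sub_self] at hG
    have h1 := hasSum_single (f := fun v => ∑ a ∈ G.ends v,
      (⟪n a, F (G.endVertex a)⟫_ℂ - ⟪t a, m a⟫_ℂ)) v fun u hu =>
        Finset.sum_eq_zero fun a ha => by
          rw [mem_ends.1 ha, hFu u hu, hm a fun h => hu (by rw [← mem_ends.1 ha, mem_ends.1 h]),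
            inner_zero_right, inner_zero_right, sub_self]
    have h2 := h1.unique hG
    rw [Finset.sum_sub_distrib, sub_eq_zero] at h2
    rw [← h2]
    exact Finset.sum_congr rfl fun a ha => by rw [mem_ends.1 ha, hFv]
  have hsingle : ∀ {v : V} {a : E ⊕ E}, a ∈ G.ends v → ∀ z : Spinor,
      (∀ b, b ∉ G.ends v → (Pi.single a z : E ⊕ E → Spinor) b = 0) ∧
      (∑ b ∈ G.ends v, (Pi.single a z : E ⊕ E → Spinor) b = z) ∧
      ∑ b ∈ G.ends v, ⟪t b, (Pi.single a z : E ⊕ E → Spinor) b⟫_ℂ = ⟪t a, z⟫_ℂ := by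
    intro v a ha z
    refine ⟨fun b hb => Pi.single_eq_of_ne (fun h => hb (by rwa [h])) _, ?_, ?_⟩
    · rw [Finset.sum_eq_single_of_mem a ha fun b _ hb => Pi.single_eq_of_ne hb _, Pi.single_eq_same]
    · rw [Finset.sum_eq_single_of_mem a ha fun b _ hb => by
        rw [Pi.single_eq_of_ne hb, inner_zero_right], Pi.single_eq_same]
  have hcont : ∀ a b, G.endVertex a = G.endVertex b → t a = t b := by
    intro a b hab
    refine ext_inner_right ℂ fun z => ?_
    have ha : a ∈ G.ends (G.endVertex b) := mem_ends.2 hab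
    have hb : b ∈ G.ends (G.endVertex b) := mem_ends.2 rfl
    obtain ⟨a₁, a₂, a₃⟩ := hsingle ha z
    obtain ⟨b₁, b₂, b₃⟩ := hsingle hb z
    -- Value zero and opposite derivatives at two ends of the same vertex are admissible for every
    -- `ε`, and compare `t a` with `t b`.
    have := key (G.endVertex b) 0 (Pi.single a z - Pi.single b z)
      (fun k hk => by rw [Pi.sub_apply, a₁ k hk, b₁ k hk, sub_zero])
      (by simp only [Pi.sub_apply, Finset.sum_sub_distrib, a₂, b₂, sub_self, smul_zero])
    simp only [Pi.sub_apply, inner_sub_right, Finset.sum_sub_distrib, a₃, b₃, inner_zero_right,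
      Finset.sum_const_zero] at this
    exact (sub_eq_zero.1 this.symm)
  -- At an isolated vertex the derivative sum is empty, so the value `0` is needed there for the
  -- condition to hold with arbitrary `ε v`.
  set F : V → Spinor := fun v => if h : ∃ a, G.endVertex a = v then t h.choose else 0 with hF
  have htF : t = fun a => F (G.endVertex a) := by
    funext a
    have hex : ∃ b, G.endVertex b = G.endVertex a := ⟨a, rfl⟩
    rw [hF]
    simp only [dif_pos hex]
    exact hcont _ _ hex.choose_spec.symm
  have hvert : ∀ v, ∑ a ∈ G.ends v, n a = (ε v : ℂ) • F v := by
    intro v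
    by_cases hex : ∃ a, G.endVertex a = v
    · obtain ⟨a, rfl⟩ := hex
      refine ext_inner_right ℂ fun c => ?_
      -- Value `c` with the whole derivative `ε c` placed on one end is admissible, and yields the
      -- derivative condition paired with `c`.
      obtain ⟨a₁, a₂, a₃⟩ := hsingle (mem_ends.2 rfl : a ∈ G.ends (G.endVertex a))
        ((ε (G.endVertex a) : ℂ) • c)
      rw [sum_inner, key _ c _ a₁ a₂, a₃, htF, inner_smul_left, inner_smul_right,
        Complex.conj_ofReal]
    · rw [hF]
      simp only [dif_neg hex, smul_zero]
      exact Finset.sum_eq_zero fun a ha => absurd ⟨a, mem_ends.1 ha⟩ hex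
  rw [htF] at ht
  have hmem : f ∈ (G.rashbaHamiltonian d A kR ε).domain := by
    refine ⟨fun e => (hint e).1, ?_, ht.vertexConditions hvert⟩
    rw [show (fun e => edgeRashba (d e) (A e) kR (f e)) = w from funext fun e => (hint e).2]
    exact lp.memℓp w
  exact ⟨hmem, lp.ext (funext fun e => (hint e).2)⟩

/-- The Rashba Hamiltonian is self-adjoint. -/
theorem isSelfAdjoint_rashbaHamiltonian : IsSelfAdjoint (G.rashbaHamiltonian d A kR ε) := by
  have hd : Dense ((G.rashbaHamiltonian d A kR ε).domain : Set (GraphL2 G)) :=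
    dense_rashbaHamiltonian_domain
  rw [LinearPMap.isSelfAdjoint_def]
  have hle : (G.rashbaHamiltonian d A kR ε).adjoint ≤ G.rashbaHamiltonian d A kR ε := by
    refine ⟨fun f hf => ?_, fun f g hfg => ?_⟩
    · exact (mem_rashbaDomain_of_adjoint fun x =>
        LinearPMap.adjoint_isFormalAdjoint hd ⟨f, hf⟩ x).1
    · obtain ⟨hf, he⟩ := mem_rashbaDomain_of_adjoint fun x =>
        LinearPMap.adjoint_isFormalAdjoint hd f x
      rw [← he]
      congr 1
      exact Subtype.ext hfg
  exact le_antisymm hle (rashbaHamiltonian_isFormalAdjoint.le_adjoint hd)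

end MetricGraph

end QuantumGraph

theorem mainTheorem2 {V E : Type*} (G : QuantumGraph.MetricGraph V E)
    (d : E → EuclideanSpace ℝ (Fin 2)) (hd : ∀ e, ‖d e‖ = 1)
    (A : E → ℝ) (kR : ℝ) (ε : V → ℝ) :
    Dense ((G.rashbaHamiltonian d A kR ε).domain : Set (QuantumGraph.GraphL2 G)) ∧
      IsSelfAdjoint (G.rashbaHamiltonian d A kR ε) :=
  ⟨QuantumGraph.MetricGraph.dense_rashbaHamiltonian_domain,
    QuantumGraph.MetricGraph.isSelfAdjoint_rashbaHamiltonian⟩
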